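/- Let $\mu,\nu,\sigma>0$, and let $(\alpha_k)_{k\ge1}$, $(\beta_k)_{k\ge1}$, $(\gamma_k)_{k\ge1}$ be random variables on a probability space, all of them (jointly) independent, such that for every $k$ the variables $\alpha_k,\beta_k,\gamma_k$ are exponentially distributed with parameters (rates) $\mu,\nu,\sigma$ respectively. Consider the linear system $\boldsymbol z(k)=A(k)\boldsymbol z(k-1)$ over the semiring of real numbers with the operations maximum and addition, with $$A(k)=\begin{pmatrix}\alpha_k&\beta_k\\ \gamma_k&0\end{pmatrix},\qquad \boldsymbol z(k)=\begin{pmatrix}x(k)\\ y(k)\end{pmatrix},\qquad x(0)=y(0)=0,$$ that is, $x(k)=\max(x(k-1)+\alpha_k,\;y(k-1)+\beta_k)$ and $y(k)=\max(x(k-1)+\gamma_k,\;y(k-1))$ for $k\ge1$. In each of the two cases below, the limit $$\lambda=\lim_{k\to\infty}\frac1k\max(x(k),y(k))$$ (the Lyapunov exponent of the system) exists almost surely and is almost surely equal to the stated constant. (1) If $\sigma=\mu$, then $$\lambda=\frac{48\mu^{5}+238\mu^{4}\nu+495\mu^{3}\nu^{2}+581\mu^{2}\nu^{3}+326\mu\nu^{4}+68\nu^{5}}{2\mu\nu\,(36\mu^{4}+147\mu^{3}\nu+215\mu^{2}\nu^{2}+130\mu\nu^{3}+28\nu^{4})}.$$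 (2) If $\sigma=\nu$, then $\lambda=P(\mu,\nu)/Q(\mu,\nu)$, where $$P(\mu,\nu)=15\mu^{8}+152\mu^{7}\nu+624\mu^{6}\nu^{2}+1382\mu^{5}\nu^{3}+1838\mu^{4}\nu^{4}+1592\mu^{3}\nu^{5}+973\mu^{2}\nu^{6}+384\mu\nu^{7}+64\nu^{8},$$ $$Q(\mu,\nu)=\mu\nu(\mu+\nu)^{2}(12\mu^{5}+97\mu^{4}\nu+286\mu^{3}\nu^{2}+397\mu^{2}\nu^{3}+256\mu\nu^{4}+64\nu^{5}).$$ -/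

import Mathlib

open MeasureTheory ProbabilityTheory Filter Topology

/-- The product of a `2 × 2` matrix and a vector over the semiring of real numbers in which the
addition is the maximum and the multiplication is the ordinary addition. -/
def maxPlusMulVec (A : Matrix (Fin 2) (Fin 2) ℝ) (v : Fin 2 → ℝ) : Fin 2 → ℝ :=
  fun i => max (v 0 + A i 0) (v 1 + A i 1)

/-- The trajectory of the max-plus linear system `z (k + 1) = A k ⊗ z k` started at `z 0 = 0`.
The matrix called `A k` here acts in the step from time `k` to time `k + 1`. -/
def maxPlusState (A : ℕ → Matrix (Fin 2) (Fin 2) ℝ) : ℕ → Fin 2 → ℝ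
  | 0 => 0
  | k + 1 => maxPlusMulVec (A k) (maxPlusState A k)

/-- `l` is the Lyapunov exponent of the random max-plus linear system with state transition
matrices `A 0, A 1, …`: with probability one, `max (x k) (y k) / k → l` as `k → ∞`, where
`x k`, `y k` are the coordinates of the state vector. -/
def IsLyapunovExponent {Ω : Type*} [MeasurableSpace Ω] (P : Measure Ω)
    (A : ℕ → Ω → Matrix (Fin 2) (Fin 2) ℝ) (l : ℝ) : Prop :=
  ∀ᵐ ω ∂P, Tendsto
    (fun k : ℕ => (1 / (k : ℝ)) *
      max (maxPlusState (fun j => A j ω) k 0) (maxPlusState (fun j => A j ω) k 1))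
    atTop (𝓝 l)

/-!
The idea is to solve the Poisson equation of the chain `z k`. By lack of memory, one step of the
system from a state with coordinates `x` and `y` restarts, with a probability depending only on
`x - y`, at one of the points `(max α β, γ)`, `(α, γ)`, `(β, 0)`, `(max α β, 0)`, `(β, γ)` relative
to `max x y`. Hence adding to `max x y` a suitable bounded function of `x - y`, an average of five
unknown constants over these regimes, gives a function `φ` whose mean increases by the same amount
`l` in a step from any state; the constants and `l` solve a finite linear system.

The process `φ (z k) - l * k` then has orthogonal and `L²`-bounded increments, so that its quotient
by `k` tends to zero almost surely along the squares. As `φ` differs from the maximum of the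
coordinates by a bounded amount, and this maximum is nondecreasing along trajectories, the
convergence extends from the squares to all times.
-/

section

variable {Ω : Type*} [MeasurableSpace Ω] {P : Measure Ω}

/-! ### Exponential laws and lack of memory -/

theorem expMeasure_eq_withDensity (r : ℝ) :
    expMeasure r = (volume.restrict (Set.Ioi 0)).withDensity
      fun x => ENNReal.ofReal (r * Real.exp (-(r * x))) := by
  have density_eq : exponentialPDF r =
      (Set.Ici 0).indicator fun x => ENNReal.ofReal (r * Real.exp (-(r * x))) := by
    ext x
    rw [exponentialPDF_eq, Set.indicator_apply]
    simp only [Set.mem_Ici]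
    split_ifs <;> simp
  rw [Measure.restrict_congr_set Ioi_ae_eq_Ici, ← withDensity_indicator measurableSet_Ici,
    ← density_eq]
  rfl

theorem ae_pos_expMeasure (r : ℝ) : ∀ᵐ x ∂expMeasure r, 0 < x := by
  rw [expMeasure_eq_withDensity]
  exact withDensity_absolutelyContinuous _ _ (ae_restrict_mem measurableSet_Ioi)

theorem expMeasure_Ici {r : ℝ} (hr : 0 < r) (t : ℝ) :
    expMeasure r (Set.Ici t) = ENNReal.ofReal (Real.exp (-(r * max t 0))) := by
  have := isProbabilityMeasure_expMeasure hr
  have : NullSingletonClass (expMeasure r) := by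
    rw [expMeasure_eq_withDensity]; infer_instance
  rw [← measure_congr Ioi_ae_eq_Ici, ← ofReal_measureReal, ← Set.compl_Iic,
    probReal_compl_eq_one_sub measurableSet_Iic, ← cdf_eq_real, cdf_expMeasure_eq hr]
  split_ifs with ht
  · rw [max_eq_left ht, sub_sub_cancel]
  · rw [max_eq_right (not_le.1 ht).le, mul_zero, neg_zero, Real.exp_zero, sub_zero]

theorem integral_expMeasure {r : ℝ} (hr : 0 < r) (f : ℝ → ℝ) :
    ∫ x, f x ∂expMeasure r = ∫ x in Set.Ioi 0, r * Real.exp (-(r * x)) * f x := by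
  rw [expMeasure_eq_withDensity, integral_withDensity_eq_integral_toReal_smul (by fun_prop)
    (by simp)]
  congr with x
  rw [ENNReal.toReal_ofReal (by positivity), smul_eq_mul]

theorem integral_exp_neg_mul_expMeasure {r c : ℝ} (hr : 0 < r) (hc : 0 < r + c) :
    ∫ x, Real.exp (-(c * x)) ∂expMeasure r = r / (r + c) := by
  calc ∫ x, Real.exp (-(c * x)) ∂expMeasure r
      = ∫ x in Set.Ioi 0, r * Real.exp (-(r + c) * x) := by
        rw [integral_expMeasure hr]
        congr with x
        rw [mul_assoc, ← Real.exp_add]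
        ring_nf
    _ = r / (r + c) := by
        rw [integral_const_mul, integral_exp_mul_Ioi (neg_neg_of_pos hc), mul_zero,
          Real.exp_zero, neg_div_neg_eq, mul_one_div]

theorem integrable_exp_neg_mul_expMeasure {r c : ℝ} (hr : 0 < r) (hc : 0 < r + c) :
    Integrable (fun x => Real.exp (-(c * x))) (expMeasure r) := by
  refine .of_integral_ne_zero ?_
  rw [integral_exp_neg_mul_expMeasure hr hc]
  positivity

theorem integral_id_expMeasure {r : ℝ} (hr : 0 < r) : ∫ x, x ∂expMeasure r = 1 / r := by
  have moment : ∫ x in Set.Ioi 0, x * Real.exp (-(r * x)) = (1 / r) ^ 2 := by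
    have gamma_integral := Real.integral_rpow_mul_exp_neg_mul_Ioi (a := 2) two_pos hr
    have two_sub_one : (2 : ℝ) - 1 = 1 := by norm_num
    simpa only [two_sub_one, Real.rpow_one, Real.Gamma_two, mul_one, Real.rpow_ofNat]
      using gamma_integral
  calc ∫ x, x ∂expMeasure r = r * ∫ x in Set.Ioi 0, x * Real.exp (-(r * x)) := by
        rw [integral_expMeasure hr, ← integral_const_mul]
        congr with x
        ring
    _ = 1 / r := by
        rw [moment]
        field_simp

theorem memLp_id_expMeasure {r : ℝ} (hr : 0 < r) (p : NNReal) : MemLp id p (expMeasure r) := by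
  refine memLp_of_mem_interior_integrableExpSet ?_ p
  refine mem_interior.2 ⟨Set.Iio r, fun t ht => ?_, isOpen_Iio, hr⟩
  simpa [integrableExpSet] using
    integrable_exp_neg_mul_expMeasure (c := -t) hr (sub_pos.2 (Set.mem_Iio.1 ht))

theorem integrable_id_expMeasure {r : ℝ} (hr : 0 < r) : Integrable id (expMeasure r) :=
  memLp_one_iff_integrable.1 (memLp_id_expMeasure hr 1)

/-- The law of a random variable that vanishes with probability `1 - p` and has law `m` with
probability `p`. -/
noncomputable def zeroInflated (p : ℝ) (m : Measure ℝ) : Measure ℝ :=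
  ENNReal.ofReal (1 - p) • Measure.dirac 0 + ENNReal.ofReal p • m

theorem zeroInflated_Ici_of_pos (p : ℝ) (m : Measure ℝ) {t : ℝ} (ht : 0 < t) :
    zeroInflated p m (Set.Ici t) = ENNReal.ofReal p * m (Set.Ici t) := by
  simp [zeroInflated, ht]

theorem isProbabilityMeasure_zeroInflated {p : ℝ} (hp : p ∈ Set.Icc 0 1) (m : Measure ℝ)
    [IsProbabilityMeasure m] : IsProbabilityMeasure (zeroInflated p m) where
  measure_univ := by
    simp [zeroInflated, ← ENNReal.ofReal_add (sub_nonneg.2 hp.2) hp.1]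

theorem hasLaw_zeroInflated_expMeasure [IsProbabilityMeasure P] {Z : Ω → ℝ} {p r : ℝ}
    (hp : p ∈ Set.Icc 0 1) (hr : 0 < r) (hZ : AEMeasurable Z P) (Z_nonneg : ∀ ω, 0 ≤ Z ω)
    (tail : ∀ t, 0 < t → P {ω | t ≤ Z ω} = ENNReal.ofReal (p * Real.exp (-(r * t)))) :
    HasLaw Z (zeroInflated p (expMeasure r)) P := by
  have := isProbabilityMeasure_expMeasure hr
  have := isProbabilityMeasure_zeroInflated hp (expMeasure r)
  have := Measure.isProbabilityMeasure_map hZ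
  refine ⟨hZ, Measure.ext_of_Ici _ _ fun t => ?_⟩
  rcases lt_or_ge 0 t with ht | ht
  · rw [Measure.map_apply_of_aemeasurable hZ measurableSet_Ici, zeroInflated_Ici_of_pos _ _ ht,
      expMeasure_Ici hr, max_eq_left ht.le, ← ENNReal.ofReal_mul hp.1]
    exact tail t ht
  · have full_of_Ici_zero {m : Measure ℝ} [IsProbabilityMeasure m] (hm : m (Set.Ici 0) = 1) :
        m (Set.Ici t) = 1 :=
      one_le_prob_iff.1 (hm ▸ measure_mono (Set.Ici_subset_Ici.2 ht))
    rw [full_of_Ici_zero, full_of_Ici_zero]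
    · simp [zeroInflated, expMeasure_Ici hr, ← ENNReal.ofReal_add (sub_nonneg.2 hp.2) hp.1]
    · rw [Measure.map_apply_of_aemeasurable hZ measurableSet_Ici]
      simp [Set.preimage, Z_nonneg]

theorem hasLaw_posPart_sub_const [IsProbabilityMeasure P] {X : Ω → ℝ} {r c : ℝ} (hr : 0 < r)
    (hc : 0 ≤ c) (hX : HasLaw X (expMeasure r) P) :
    HasLaw (fun ω => max (X ω - c) 0)
      (zeroInflated (Real.exp (-(r * c))) (expMeasure r)) P := by
  refine hasLaw_zeroInflated_expMeasure
    ⟨(Real.exp_pos _).le, Real.exp_le_one_iff.2 (neg_nonpos.2 (by positivity))⟩ hr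
    ((hX.aemeasurable.sub_const c).max aemeasurable_const) (fun ω => le_max_right _ _)
    fun t ht => ?_
  calc P {ω | t ≤ max (X ω - c) 0} = P {ω | t + c ≤ X ω} := by
        simp [ht.not_ge, le_sub_iff_add_le]
    _ = expMeasure r (Set.Ici (t + c)) := hX.measure_eq measurableSet_Ici
    _ = _ := by
        rw [expMeasure_Ici hr, max_eq_left (by positivity), ← Real.exp_add]
        ring_nf

theorem hasLaw_posPart_sub_of_indepFun [IsProbabilityMeasure P] {X Y : Ω → ℝ} {r s : ℝ}
    (hr : 0 < r) (hs : 0 < s) (hX : HasLaw X (expMeasure r) P) (hY : HasLaw Y (expMeasure s) P)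
    (hXY : IndepFun X Y P) :
    HasLaw (fun ω => max (X ω - Y ω) 0) (zeroInflated (s / (s + r)) (expMeasure r)) P := by
  have := isProbabilityMeasure_expMeasure hr
  have := isProbabilityMeasure_expMeasure hs
  refine hasLaw_zeroInflated_expMeasure
    ⟨by positivity, (div_le_one (by positivity)).2 (by linarith)⟩ hr
    ((hX.aemeasurable.sub hY.aemeasurable).max aemeasurable_const)
    (fun ω => le_max_right _ _) fun t ht => ?_
  have measurable_tail : MeasurableSet {z : ℝ × ℝ | t + z.1 ≤ z.2} :=
    measurableSet_le (by fun_prop) (by fun_prop)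
  calc P {ω | t ≤ max (X ω - Y ω) 0} = P {ω | t + Y ω ≤ X ω} := by
        simp [ht.not_ge, le_sub_iff_add_le]
    _ = ∫⁻ y, expMeasure r (Set.Ici (t + y)) ∂expMeasure s := by
        rw [(hXY.symm.hasLaw_prod hY hX).measure_eq (p := fun z => t + z.1 ≤ z.2) measurable_tail,
          Measure.prod_apply measurable_tail]
        rfl
    _ = ∫⁻ y, ENNReal.ofReal (Real.exp (-(r * t)) * Real.exp (-(r * y))) ∂expMeasure s := by
        refine lintegral_congr_ae ?_
        filter_upwards [ae_pos_expMeasure s] with y hy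
        rw [expMeasure_Ici hr, max_eq_left (by positivity), ← Real.exp_add]
        ring_nf
    _ = _ := by
        rw [← ofReal_integral_eq_lintegral_ofReal
          ((integrable_exp_neg_mul_expMeasure hs (by positivity)).const_mul _)
          (ae_of_all _ fun y => by positivity), integral_const_mul,
          integral_exp_neg_mul_expMeasure hs (by positivity), mul_comm]

theorem hasLaw_min_of_indepFun [IsProbabilityMeasure P] {X Y : Ω → ℝ} {r s : ℝ} (hr : 0 < r)
    (hs : 0 < s) (hX : HasLaw X (expMeasure r) P) (hY : HasLaw Y (expMeasure s) P)
    (hXY : IndepFun X Y P) :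
    HasLaw (fun ω => min (X ω) (Y ω)) (expMeasure (r + s)) P := by
  have aemeasurable_min : AEMeasurable (fun ω => min (X ω) (Y ω)) P :=
    hX.aemeasurable.min hY.aemeasurable
  have := Measure.isProbabilityMeasure_map aemeasurable_min
  refine ⟨aemeasurable_min, Measure.ext_of_Ici _ _ fun t => ?_⟩
  calc P.map (fun ω => min (X ω) (Y ω)) (Set.Ici t)
      = P (X ⁻¹' Set.Ici t ∩ Y ⁻¹' Set.Ici t) := by
        rw [Measure.map_apply_of_aemeasurable aemeasurable_min measurableSet_Ici]
        congr with ω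
        simp
    _ = expMeasure r (Set.Ici t) * expMeasure s (Set.Ici t) := by
        rw [hXY.measure_inter_preimage_eq_mul _ _ measurableSet_Ici measurableSet_Ici,
          ← Measure.map_apply_of_aemeasurable hX.aemeasurable measurableSet_Ici,
          ← Measure.map_apply_of_aemeasurable hY.aemeasurable measurableSet_Ici,
          hX.map_eq, hY.map_eq]
    _ = expMeasure (r + s) (Set.Ici t) := by
        rw [expMeasure_Ici hr, expMeasure_Ici hs, expMeasure_Ici (add_pos hr hs),
          ← ENNReal.ofReal_mul (Real.exp_pos _).le, ← Real.exp_add]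
        ring_nf

theorem integral_zeroInflated {p : ℝ} (hp : p ∈ Set.Icc 0 1) {m : Measure ℝ} {f : ℝ → ℝ}
    (hf : Integrable f m) :
    ∫ x, f x ∂zeroInflated p m = (1 - p) * f 0 + p * ∫ x, f x ∂m := by
  rw [zeroInflated, integral_add_measure ((integrable_dirac (by simp)).smul_measure (by simp))
    (hf.smul_measure (by simp)), integral_smul_measure, integral_smul_measure, integral_dirac,
    ENNReal.toReal_ofReal (sub_nonneg.2 hp.2), ENNReal.toReal_ofReal hp.1, smul_eq_mul, smul_eq_mul]

theorem integral_zeroInflated_prod {E : Type*} [MeasurableSpace E] {κ : Measure E} [SFinite κ]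
    {p : ℝ} (hp : p ∈ Set.Icc 0 1) {m : Measure ℝ} [SFinite m] {f : ℝ × E → ℝ}
    (hf : Measurable f) (hf₀ : Integrable (fun w => f (0, w)) κ) (hfm : Integrable f (m.prod κ)) :
    ∫ z, f z ∂(zeroInflated p m).prod κ =
      (1 - p) * ∫ w, f (0, w) ∂κ + p * ∫ z, f z ∂m.prod κ := by
  have hf₀' : Integrable f ((Measure.dirac (0 : ℝ)).prod κ) := by
    rw [Measure.dirac_prod]
    exact (integrable_map_measure hf.aestronglyMeasurable (by fun_prop)).2 hf₀
  rw [zeroInflated, Measure.add_prod, Measure.prod_smul_left, Measure.prod_smul_left,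
    integral_add_measure (hf₀'.smul_measure (by simp)) (hfm.smul_measure (by simp)),
    integral_smul_measure, integral_smul_measure, Measure.dirac_prod,
    integral_map (by fun_prop) hf.aestronglyMeasurable, ENNReal.toReal_ofReal (sub_nonneg.2 hp.2),
    ENNReal.toReal_ofReal hp.1, smul_eq_mul, smul_eq_mul]

theorem integrable_zeroInflated {p : ℝ} {m : Measure ℝ} {f : ℝ → ℝ} (hf : Integrable f m) :
    Integrable f (zeroInflated p m) :=
  ((integrable_dirac (by simp)).smul_measure (by simp)).add_measure (hf.smul_measure (by simp))

theorem integral_comp_posPart_sub_const [IsProbabilityMeasure P] {E : Type*} [MeasurableSpace E]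
    {X : Ω → ℝ} {W : Ω → E} {r c : ℝ} (hr : 0 < r) (hc : 0 ≤ c)
    (hX : HasLaw X (expMeasure r) P) (hW : AEMeasurable W P) (hXW : IndepFun X W P)
    {F : ℝ → E → ℝ} (hF : Measurable (Function.uncurry F))
    (integrable_zero : Integrable (fun ω => F 0 (W ω)) P)
    (integrable_restart : Integrable (fun ω => F (X ω) (W ω)) P) :
    ∫ ω, F (max (X ω - c) 0) (W ω) ∂P =
      (1 - Real.exp (-(r * c))) * ∫ ω, F 0 (W ω) ∂P +
        Real.exp (-(r * c)) * ∫ ω, F (X ω) (W ω) ∂P := by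
  have := isProbabilityMeasure_expMeasure hr
  have := Measure.isProbabilityMeasure_map hW
  have law_W : HasLaw W (P.map W) P := ⟨hW, rfl⟩
  have law_XW := hXW.hasLaw_prod hX law_W
  have law_posPart := (hXW.comp (φ := fun x => max (x - c) 0) (by fun_prop)
    measurable_id).hasLaw_prod (hasLaw_posPart_sub_const hr hc hX) law_W
  have hF₀ : Measurable (F 0) := hF.of_uncurry_left
  calc ∫ ω, F (max (X ω - c) 0) (W ω) ∂P
      = ∫ z, Function.uncurry F z
          ∂(zeroInflated (Real.exp (-(r * c))) (expMeasure r)).prod (P.map W) :=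
        law_posPart.integral_comp hF.aestronglyMeasurable
    _ = (1 - Real.exp (-(r * c))) * ∫ w, F 0 w ∂P.map W + Real.exp (-(r * c)) *
          ∫ z, Function.uncurry F z ∂(expMeasure r).prod (P.map W) := by
        refine integral_zeroInflated_prod
          ⟨(Real.exp_pos _).le, Real.exp_le_one_iff.2 (neg_nonpos.2 (by positivity))⟩ hF
          ((integrable_map_measure hF₀.aestronglyMeasurable hW).2 integrable_zero) ?_
        rw [← law_XW.map_eq]
        exact (integrable_map_measure hF.aestronglyMeasurable law_XW.aemeasurable).2
          integrable_restart
    _ = _ := by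
        rw [← law_XW.integral_comp hF.aestronglyMeasurable,
          integral_map hW hF₀.aestronglyMeasurable]
        rfl

theorem integral_comp_sub_of_indepFun [IsProbabilityMeasure P] {X Y : Ω → ℝ} {r s : ℝ}
    (hr : 0 < r) (hs : 0 < s) (hX : HasLaw X (expMeasure r) P) (hY : HasLaw Y (expMeasure s) P)
    (hXY : IndepFun X Y P) {f : ℝ → ℝ} (hf : Measurable f) (hfr : Integrable f (expMeasure r))
    (hfs : Integrable (fun x => f (-x)) (expMeasure s)) :
    ∫ ω, f (X ω - Y ω) ∂P =
      s / (s + r) * ∫ x, f x ∂expMeasure r + r / (r + s) * ∫ x, f (-x) ∂expMeasure s := by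
  have law_pos := hasLaw_posPart_sub_of_indepFun hr hs hX hY hXY
  have law_neg := hasLaw_posPart_sub_of_indepFun hs hr hY hX hXY.symm
  have weight_mem {a b : ℝ} (ha : 0 < a) (hb : 0 < b) : a / (a + b) ∈ Set.Icc 0 1 :=
    ⟨by positivity, (div_le_one (by positivity)).2 (by linarith)⟩
  have pos : ∫ ω, f (max (X ω - Y ω) 0) ∂P =
      (1 - s / (s + r)) * f 0 + s / (s + r) * ∫ x, f x ∂expMeasure r :=
    (law_pos.integral_comp hf.aestronglyMeasurable).trans
      (integral_zeroInflated (weight_mem hs hr) hfr)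
  have neg : ∫ ω, f (-max (Y ω - X ω) 0) ∂P =
      (1 - r / (r + s)) * f (-0) + r / (r + s) * ∫ x, f (-x) ∂expMeasure s :=
    (law_neg.integral_comp (hf.comp measurable_neg).aestronglyMeasurable).trans
      (integral_zeroInflated (weight_mem hr hs) hfs)
  have integrable_pos : Integrable (fun ω => f (max (X ω - Y ω) 0)) P :=
    ((law_pos.identDistrib .id).comp hf).integrable_iff.2 (integrable_zeroInflated hfr)
  have integrable_neg : Integrable (fun ω => f (-max (Y ω - X ω) 0)) P :=
    ((law_neg.identDistrib .id).comp (hf.comp measurable_neg)).integrable_iff.2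
      (integrable_zeroInflated hfs)
  have split (ω : Ω) : f (X ω - Y ω) =
      f (max (X ω - Y ω) 0) + f (-max (Y ω - X ω) 0) - f 0 := by
    rcases le_total (X ω) (Y ω) with h | h <;> simp [h]
  calc ∫ ω, f (X ω - Y ω) ∂P
      = ∫ ω, f (max (X ω - Y ω) 0) ∂P + ∫ ω, f (-max (Y ω - X ω) 0) ∂P - f 0 := by
        simp_rw [split]
        rw [integral_sub (integrable_pos.fun_add integrable_neg) (integrable_const _),
          integral_add integrable_pos integrable_neg, integral_const, probReal_univ, one_smul]
    _ = _ := by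
        rw [pos, neg, neg_zero]
        field_simp
        ring

/-! ### One step of the potential -/

/-- The translation-equivariant function on the plane that extends the function `h` of the
difference of the two coordinates. -/
noncomputable def potential (h : ℝ → ℝ) (x y : ℝ) : ℝ := max x y + h (x - y)

theorem potential_add_add (h : ℝ → ℝ) (t x y : ℝ) :
    potential h (t + x) (t + y) = t + potential h x y := by
  simp only [potential, max_add_add_left, add_sub_add_left_eq_sub, add_assoc]

theorem measurable_potential {h : ℝ → ℝ} (hh : Measurable h) :
    Measurable (Function.uncurry (potential h)) := by
  unfold potential Function.uncurry
  fun_prop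

theorem integrable_potential [IsFiniteMeasure P] {h : ℝ → ℝ} {B : ℝ} (hh : Measurable h)
    (hB : ∀ d, |h d| ≤ B) {X Y : Ω → ℝ} (hX : Integrable X P) (hY : Integrable Y P) :
    Integrable (fun ω => potential h (X ω) (Y ω)) P :=
  (hX.sup hY).add <| .of_bound (hh.comp_aemeasurable
    (hX.1.aemeasurable.sub hY.1.aemeasurable)).aestronglyMeasurable B (ae_of_all _ fun _ => hB _)

theorem integrable_of_hasLaw_expMeasure {X : Ω → ℝ} {r : ℝ} (hr : 0 < r)
    (hX : HasLaw X (expMeasure r) P) : Integrable X P :=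
  (hX.identDistrib .id).integrable_iff.2 (integrable_id_expMeasure hr)

theorem ae_nonneg_of_hasLaw_expMeasure {X : Ω → ℝ} {r : ℝ} (hX : HasLaw X (expMeasure r) P) :
    ∀ᵐ ω ∂P, 0 ≤ X ω :=
  (hX.ae_iff (p := fun x => 0 ≤ x) (by fun_prop)).2 ((ae_pos_expMeasure r).mono fun _ => le_of_lt)

theorem integral_potential_zero [IsProbabilityMeasure P] {h : ℝ → ℝ} {B : ℝ} (hh : Measurable h)
    (hB : ∀ d, |h d| ≤ B) {r : ℝ} (hr : 0 < r) {X : Ω → ℝ} (hX : HasLaw X (expMeasure r) P) :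
    ∫ ω, potential h (X ω) 0 ∂P = 1 / r + ∫ x, h x ∂expMeasure r := by
  have := isProbabilityMeasure_expMeasure hr
  calc ∫ ω, potential h (X ω) 0 ∂P
      = ∫ x, potential h x 0 ∂expMeasure r :=
        hX.integral_comp (f := fun x => potential h x 0)
          (measurable_potential hh).of_uncurry_right.aestronglyMeasurable
    _ = ∫ x, (x + h x) ∂expMeasure r := by
        refine integral_congr_ae ?_
        filter_upwards [ae_pos_expMeasure r] with x hx
        rw [potential, max_eq_left hx.le, sub_zero]
    _ = _ := by
        rw [integral_add (f := fun x => x) (integrable_id_expMeasure hr)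
          (.of_bound hh.aestronglyMeasurable B (ae_of_all _ hB)), integral_id_expMeasure hr]

theorem integral_potential_of_indepFun [IsProbabilityMeasure P] {h : ℝ → ℝ} {B : ℝ}
    (hh : Measurable h) (hB : ∀ d, |h d| ≤ B) {r s : ℝ} (hr : 0 < r) (hs : 0 < s) {X Y : Ω → ℝ}
    (hX : HasLaw X (expMeasure r) P) (hY : HasLaw Y (expMeasure s) P) (hXY : IndepFun X Y P) :
    ∫ ω, potential h (X ω) (Y ω) ∂P = 1 / s + s / (s + r) * (1 / r + ∫ x, h x ∂expMeasure r) +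
      r / (r + s) * ∫ x, h (-x) ∂expMeasure s := by
  have := isProbabilityMeasure_expMeasure hr
  have := isProbabilityMeasure_expMeasure hs
  set f : ℝ → ℝ := fun d => max d 0 + h d with hf
  have potential_eq (x y : ℝ) : potential h x y = y + f (x - y) := by
    rw [potential, hf, ← add_assoc, ← max_add_add_left, add_sub_cancel, add_zero]
  have f_pos : f =ᵐ[expMeasure r] fun x => x + h x := by
    filter_upwards [ae_pos_expMeasure r] with x hx
    simp only [hf, max_eq_left hx.le]
  have f_neg : (fun x => f (-x)) =ᵐ[expMeasure s] fun x => h (-x) := by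
    filter_upwards [ae_pos_expMeasure s] with x hx
    simp only [hf, max_eq_right (neg_nonpos.2 hx.le), zero_add]
  have integrable_h : Integrable h (expMeasure r) :=
    .of_bound hh.aestronglyMeasurable B (ae_of_all _ hB)
  have integrable_h_neg : Integrable (fun x => h (-x)) (expMeasure s) :=
    .of_bound (hh.comp measurable_neg).aestronglyMeasurable B (ae_of_all _ fun x => hB _)
  have integrable_Y := integrable_of_hasLaw_expMeasure hs hY
  have integrable_f_sub : Integrable (fun ω => f (X ω - Y ω)) P := by
    have integrable_pot := integrable_potential hh hB (integrable_of_hasLaw_expMeasure hr hX)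
      integrable_Y
    refine (integrable_pot.sub integrable_Y).congr (ae_of_all _ fun ω => ?_)
    simp only [Pi.sub_apply, potential_eq, add_sub_cancel_left]
  calc ∫ ω, potential h (X ω) (Y ω) ∂P
      = ∫ ω, Y ω ∂P + ∫ ω, f (X ω - Y ω) ∂P := by
        simp_rw [potential_eq]
        exact integral_add integrable_Y integrable_f_sub
    _ = 1 / s + s / (s + r) * ∫ x, f x ∂expMeasure r +
          r / (r + s) * ∫ x, f (-x) ∂expMeasure s := by
        rw [hY.integral_eq, integral_id_expMeasure hs, integral_comp_sub_of_indepFun hr hs hX hY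
          hXY (by fun_prop) (((integrable_id_expMeasure hr).fun_add integrable_h).congr f_pos.symm)
          (integrable_h_neg.congr f_neg.symm), add_assoc]
    _ = _ := by
        rw [integral_congr_ae f_pos, integral_congr_ae f_neg,
          integral_add (f := fun x => x) (integrable_id_expMeasure hr) integrable_h,
          integral_id_expMeasure hr]

theorem integral_potential_max [IsFiniteMeasure P] {h : ℝ → ℝ} {B : ℝ} (hh : Measurable h)
    (hB : ∀ d, |h d| ≤ B) {X Y Z : Ω → ℝ} (hX : Integrable X P) (hY : Integrable Y P)
    (hZ : Integrable Z P) :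
    ∫ ω, potential h (max (X ω) (Y ω)) (Z ω) ∂P = ∫ ω, potential h (X ω) (Z ω) ∂P +
      ∫ ω, potential h (Y ω) (Z ω) ∂P - ∫ ω, potential h (min (X ω) (Y ω)) (Z ω) ∂P := by
  have integrable_X := integrable_potential hh hB hX hZ
  have integrable_Y := integrable_potential hh hB hY hZ
  have integrable_min : Integrable (fun ω => potential h (min (X ω) (Y ω)) (Z ω)) P :=
    integrable_potential hh hB (hX.inf hY) hZ
  rw [← integral_add integrable_X integrable_Y,
    ← integral_sub (integrable_X.fun_add integrable_Y) integrable_min]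
  congr 1 with ω
  rcases le_total (X ω) (Y ω) with h | h <;> simp [h]

section Step

variable [IsProbabilityMeasure P] {h : ℝ → ℝ} {B : ℝ}

theorem integral_potential_max_posPart_sub (hh : Measurable h) (hB : ∀ d, |h d| ≤ B)
    {X Y Z : Ω → ℝ} {r c : ℝ} (hr : 0 < r) (hc : 0 ≤ c) (hX : HasLaw X (expMeasure r) P)
    (hY : Integrable Y P) (hY₀ : ∀ᵐ ω ∂P, 0 ≤ Y ω) (hZ : Integrable Z P)
    (hX_YZ : IndepFun X (fun ω => (Y ω, Z ω)) P) :
    ∫ ω, potential h (max (max (X ω - c) 0) (Y ω)) (Z ω) ∂P =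
      (1 - Real.exp (-(r * c))) * ∫ ω, potential h (Y ω) (Z ω) ∂P +
        Real.exp (-(r * c)) * ∫ ω, potential h (max (X ω) (Y ω)) (Z ω) ∂P := by
  have max_zero : (fun ω => potential h (max 0 (Y ω)) (Z ω)) =ᵐ[P]
      fun ω => potential h (Y ω) (Z ω) := by
    filter_upwards [hY₀] with ω hY₀
    rw [max_eq_right hY₀]
  rw [← integral_congr_ae max_zero]
  exact integral_comp_posPart_sub_const hr hc hX (hY.1.aemeasurable.prodMk hZ.1.aemeasurable)
    hX_YZ (F := fun x w => potential h (max x w.1) w.2)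
    ((measurable_potential hh).comp (f := fun z : ℝ × ℝ × ℝ => (max z.1 z.2.1, z.2.2))
      (by fun_prop))
    ((integrable_potential hh hB hY hZ).congr max_zero.symm)
    (integrable_potential hh hB ((integrable_of_hasLaw_expMeasure hr hX).sup hY) hZ)

theorem integral_potential_posPart_sub (hh : Measurable h) (hB : ∀ d, |h d| ≤ B)
    {X Y : Ω → ℝ} {r c : ℝ} (hr : 0 < r) (hc : 0 ≤ c) (hX : HasLaw X (expMeasure r) P)
    (hY : Integrable Y P) (hXY : IndepFun X Y P) :
    ∫ ω, potential h (Y ω) (max (X ω - c) 0) ∂P =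
      (1 - Real.exp (-(r * c))) * ∫ ω, potential h (Y ω) 0 ∂P +
        Real.exp (-(r * c)) * ∫ ω, potential h (Y ω) (X ω) ∂P :=
  integral_comp_posPart_sub_const hr hc hX hY.1.aemeasurable hXY (F := fun x y => potential h y x)
    ((measurable_potential hh).comp measurable_swap)
    (integrable_potential hh hB hY (integrable_const 0))
    (integrable_potential hh hB hY (integrable_of_hasLaw_expMeasure hr hX))

variable {a b c : Ω → ℝ} {x y r s : ℝ}

theorem integral_potential_step_of_le_left (hh : Measurable h) (hB : ∀ d, |h d| ≤ B)
    (hr : 0 < r) (ha : Integrable a P) (ha₀ : ∀ᵐ ω ∂P, 0 ≤ a ω) (hb : HasLaw b (expMeasure r) P)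
    (hc : Integrable c P) (hc₀ : ∀ᵐ ω ∂P, 0 ≤ c ω)
    (hb_ac : IndepFun b (fun ω => (a ω, c ω)) P) (hyx : y ≤ x) :
    ∫ ω, potential h (max (x + a ω) (y + b ω)) (max (x + c ω) y) ∂P =
      x + ((1 - Real.exp (-(r * (x - y)))) * ∫ ω, potential h (a ω) (c ω) ∂P +
        Real.exp (-(r * (x - y))) * ∫ ω, potential h (max (a ω) (b ω)) (c ω) ∂P) := by
  have step : (fun ω => potential h (max (x + a ω) (y + b ω)) (max (x + c ω) y)) =ᵐ[P]
      fun ω => x + potential h (max (max (b ω - (x - y)) 0) (a ω)) (c ω) := by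
    filter_upwards [ha₀, hc₀] with ω ha₀ hc₀
    rw [← potential_add_add, max_eq_left (by linarith : y ≤ x + c ω)]
    congr 1
    grind
  have integrable_step : Integrable
      (fun ω => potential h (max (max (b ω - (x - y)) 0) (a ω)) (c ω)) P :=
    integrable_potential hh hB ((((integrable_of_hasLaw_expMeasure hr hb).sub
      (integrable_const _)).sup (integrable_const 0)).sup ha) hc
  simp_rw [integral_congr_ae step, max_comm (a _) (b _),
    ← integral_potential_max_posPart_sub hh hB hr (sub_nonneg.2 hyx) hb ha ha₀ hc hb_ac]
  rw [integral_add (integrable_const x) integrable_step, integral_const, probReal_univ, one_smul]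

theorem integral_potential_step_of_le_right (hh : Measurable h) (hB : ∀ d, |h d| ≤ B)
    (hr : 0 < r) (hs : 0 < s) (ha : HasLaw a (expMeasure r) P) (hb : Integrable b P)
    (hb₀ : ∀ᵐ ω ∂P, 0 ≤ b ω) (hc : HasLaw c (expMeasure s) P)
    (ha_bc : IndepFun a (fun ω => (b ω, c ω)) P) (hc_ab : IndepFun c (fun ω => (a ω, b ω)) P)
    (hxy : x ≤ y) :
    ∫ ω, potential h (max (x + a ω) (y + b ω)) (max (x + c ω) y) ∂P =
      y + ((1 - Real.exp (-(r * (y - x)))) *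
          ((1 - Real.exp (-(s * (y - x)))) * ∫ ω, potential h (b ω) 0 ∂P +
            Real.exp (-(s * (y - x))) * ∫ ω, potential h (b ω) (c ω) ∂P) +
        Real.exp (-(r * (y - x))) *
          ((1 - Real.exp (-(s * (y - x)))) * ∫ ω, potential h (max (a ω) (b ω)) 0 ∂P +
            Real.exp (-(s * (y - x))) * ∫ ω, potential h (max (a ω) (b ω)) (c ω) ∂P)) := by
  have gap_nonneg : 0 ≤ y - x := sub_nonneg.2 hxy
  have step : (fun ω => potential h (max (x + a ω) (y + b ω)) (max (x + c ω) y)) =ᵐ[P]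
      fun ω => y + potential h (max (max (a ω - (y - x)) 0) (b ω)) (max (c ω - (y - x)) 0) := by
    filter_upwards [hb₀] with ω hb₀
    rw [← potential_add_add]
    congr 1 <;> grind
  have integrable_a := integrable_of_hasLaw_expMeasure hr ha
  have integrable_max : Integrable (fun ω => max (a ω) (b ω)) P := integrable_a.sup hb
  have integrable_excess {X : Ω → ℝ} (hX : Integrable X P) :
      Integrable (fun ω => max (X ω - (y - x)) 0) P :=
    (hX.sub (integrable_const _)).sup (integrable_const 0)
  have integrable_c_excess := integrable_excess (integrable_of_hasLaw_expMeasure hs hc)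
  have ha_b_excess : IndepFun a (fun ω => (b ω, max (c ω - (y - x)) 0)) P :=
    ha_bc.comp (ψ := fun w : ℝ × ℝ => (w.1, max (w.2 - (y - x)) 0)) measurable_id (by fun_prop)
  have hc_max : IndepFun c (fun ω => max (a ω) (b ω)) P :=
    hc_ab.comp measurable_id (measurable_fst.max measurable_snd)
  have integrable_step : Integrable (fun ω =>
      potential h (max (max (a ω - (y - x)) 0) (b ω)) (max (c ω - (y - x)) 0)) P :=
    integrable_potential hh hB ((integrable_excess integrable_a).sup hb) integrable_c_excess
  rw [integral_congr_ae step, integral_add (integrable_const y) integrable_step, integral_const,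
    probReal_univ, one_smul,
    integral_potential_max_posPart_sub hh hB hr gap_nonneg ha hb hb₀ integrable_c_excess
      ha_b_excess,
    integral_potential_posPart_sub hh hB hs gap_nonneg hc hb
      (hc_ab.comp measurable_id measurable_snd),
    integral_potential_posPart_sub hh hB hs gap_nonneg hc integrable_max hc_max]

end Step

/-! ### The corrector and the Poisson equation -/

/-- The amounts by which the expected potential after a restart of a step at `(α, γ)`, `(β, 0)`,
`(max α β, 0)` or `(β, γ)` exceeds its value after a restart at `(max α β, γ)`. -/
structure RegimeExcess where
  alphaGamma : ℝ
  betaZero : ℝ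
  maxZero : ℝ
  betaGamma : ℝ

/-- The bounded function of the difference `d` of the coordinates that corrects `max` to a solution
of the Poisson equation: the average of the excesses `w` over the regime in which a step from a
state with coordinate difference `d` restarts. -/
noncomputable def corrector (μ ν σ : ℝ) (w : RegimeExcess) (d : ℝ) : ℝ :=
  (1 - Real.exp (-(ν * max d 0))) * w.alphaGamma +
    ((1 - Real.exp (-(μ * max (-d) 0))) *
        ((1 - Real.exp (-(σ * max (-d) 0))) * w.betaZero +
          Real.exp (-(σ * max (-d) 0)) * w.betaGamma) +
      Real.exp (-(μ * max (-d) 0)) * ((1 - Real.exp (-(σ * max (-d) 0))) * w.maxZero))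

section Corrector

variable {μ ν σ : ℝ} (w : RegimeExcess)

theorem corrector_of_nonneg {d : ℝ} (hd : 0 ≤ d) :
    corrector μ ν σ w d = (1 - Real.exp (-(ν * d))) * w.alphaGamma := by
  simp [corrector, hd]

theorem corrector_of_nonpos {d : ℝ} (hd : d ≤ 0) :
    corrector μ ν σ w d =
      (1 - Real.exp (-(μ * -d))) * ((1 - Real.exp (-(σ * -d))) * w.betaZero +
          Real.exp (-(σ * -d)) * w.betaGamma) +
        Real.exp (-(μ * -d)) * ((1 - Real.exp (-(σ * -d))) * w.maxZero) := by
  simp [corrector, hd]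

@[fun_prop]
theorem measurable_corrector : Measurable (corrector μ ν σ w) := by
  unfold corrector
  fun_prop

theorem abs_corrector_le (hμ : 0 ≤ μ) (hν : 0 ≤ ν) (hσ : 0 ≤ σ) (d : ℝ) :
    |corrector μ ν σ w d| ≤
      |w.alphaGamma| + (|w.betaZero| + |w.betaGamma| + |w.maxZero|) := by
  have abs_weight_mul_le {t : ℝ} (ht : t ∈ Set.Icc 0 1) (x : ℝ) : |t * x| ≤ |x| := by
    rw [abs_mul, abs_of_nonneg ht.1]
    exact mul_le_of_le_one_left (abs_nonneg x) ht.2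
  have exp_mem {r : ℝ} (hr : 0 ≤ r) (t : ℝ) : Real.exp (-(r * max t 0)) ∈ Set.Icc 0 1 :=
    ⟨(Real.exp_pos _).le, Real.exp_le_one_iff.2 (neg_nonpos.2 (by positivity))⟩
  have one_sub_mem {t : ℝ} (ht : t ∈ Set.Icc (0 : ℝ) 1) : 1 - t ∈ Set.Icc 0 1 :=
    Set.Icc.one_sub_mem ht
  refine (abs_add_le _ _).trans (add_le_add (abs_weight_mul_le (one_sub_mem (exp_mem hν _)) _) ?_)
  refine (abs_add_le _ _).trans (add_le_add ?_ ?_)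
  · refine (abs_weight_mul_le (one_sub_mem (exp_mem hμ _)) _).trans ((abs_add_le _ _).trans ?_)
    exact add_le_add (abs_weight_mul_le (one_sub_mem (exp_mem hσ _)) _)
      (abs_weight_mul_le (exp_mem hσ _) _)
  · exact (abs_weight_mul_le (exp_mem hμ _) _).trans
      (abs_weight_mul_le (one_sub_mem (exp_mem hσ _)) _)

theorem integral_corrector_expMeasure {r : ℝ} (hr : 0 < r) (hν : 0 < r + ν) :
    ∫ x, corrector μ ν σ w x ∂expMeasure r = (1 - r / (r + ν)) * w.alphaGamma := by
  have := isProbabilityMeasure_expMeasure hr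
  calc ∫ x, corrector μ ν σ w x ∂expMeasure r
      = ∫ x, (1 - Real.exp (-(ν * x))) * w.alphaGamma ∂expMeasure r := by
        refine integral_congr_ae ?_
        filter_upwards [ae_pos_expMeasure r] with x hx using corrector_of_nonneg w hx.le
    _ = _ := by
        rw [integral_mul_const, integral_sub (integrable_const _)
          (integrable_exp_neg_mul_expMeasure hr hν), integral_const, probReal_univ, one_smul,
          integral_exp_neg_mul_expMeasure hr hν]

theorem integral_corrector_neg_expMeasure {r : ℝ} (hr : 0 < r) (hμ : 0 < μ) (hσ : 0 < σ) :
    ∫ x, corrector μ ν σ w (-x) ∂expMeasure r =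
      (1 - r / (r + μ) - r / (r + σ) + r / (r + (μ + σ))) * w.betaZero +
        (r / (r + σ) - r / (r + (μ + σ))) * w.betaGamma +
          (r / (r + μ) - r / (r + (μ + σ))) * w.maxZero := by
  have := isProbabilityMeasure_expMeasure hr
  have expand : (fun x => corrector μ ν σ w (-x)) =ᵐ[expMeasure r] fun x =>
      w.betaZero + Real.exp (-(μ * x)) * (w.maxZero - w.betaZero) +
        Real.exp (-(σ * x)) * (w.betaGamma - w.betaZero) +
          Real.exp (-((μ + σ) * x)) * (w.betaZero - w.betaGamma - w.maxZero) := by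
    filter_upwards [ae_pos_expMeasure r] with x hx
    rw [corrector_of_nonpos w (neg_nonpos.2 hx.le), neg_neg, add_mul, neg_add, Real.exp_add]
    ring
  have integrable_exp_mul {s : ℝ} (hs : 0 < r + s) (t : ℝ) :
      Integrable (fun x => Real.exp (-(s * x)) * t) (expMeasure r) :=
    (integrable_exp_neg_mul_expMeasure hr hs).mul_const t
  have integrable_μ := integrable_exp_mul (add_pos hr hμ) (w.maxZero - w.betaZero)
  have integrable_σ := integrable_exp_mul (add_pos hr hσ) (w.betaGamma - w.betaZero)
  have hμσ : 0 < r + (μ + σ) := by positivity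
  rw [integral_congr_ae expand, integral_add
    (((integrable_const _).fun_add integrable_μ).fun_add integrable_σ) (integrable_exp_mul hμσ _),
    integral_add ((integrable_const _).fun_add integrable_μ) integrable_σ,
    integral_add (integrable_const _) integrable_μ, integral_mul_const, integral_mul_const,
    integral_mul_const, integral_exp_neg_mul_expMeasure hr (add_pos hr hμ),
    integral_exp_neg_mul_expMeasure hr (add_pos hr hσ), integral_exp_neg_mul_expMeasure hr hμσ,
    integral_const, probReal_univ, one_smul]
  ring

end Corrector

/-- The expected potential of `(X, 0)` for `X` exponential with rate `r`. It depends on the excesses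
only through the excess `a` of the regime `(α, γ)`. -/
noncomputable def restartMeanZero (ν a r : ℝ) : ℝ :=
  1 / r + (1 - r / (r + ν)) * a

/-- The mean of the corrector at `-Y` for `Y` exponential with rate `σ`. -/
noncomputable def correctorMeanNeg (μ σ : ℝ) (w : RegimeExcess) : ℝ :=
  (1 - σ / (σ + μ) - σ / (σ + σ) + σ / (σ + (μ + σ))) * w.betaZero +
    (σ / (σ + σ) - σ / (σ + (μ + σ))) * w.betaGamma +
      (σ / (σ + μ) - σ / (σ + (μ + σ))) * w.maxZero

/-- The expected potential of `(X, Y)` for independent exponential `X` and `Y` with rates `r` and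
`σ`. It depends on the excesses through the excess `a` of the regime `(α, γ)` and the mean `g` of
the corrector at `-Y`. -/
noncomputable def restartMean (ν σ a g r : ℝ) : ℝ :=
  1 / σ + σ / (σ + r) * restartMeanZero ν a r + r / (r + σ) * g

/-- The linear system that makes `l` the expected potential after a restart at `(max α β, γ)` and
`w` the excesses in the other four regimes. -/
structure IsPoissonSolution (μ ν σ : ℝ) (w : RegimeExcess) (l : ℝ) : Prop where
  alphaGamma : restartMean ν σ w.alphaGamma (correctorMeanNeg μ σ w) μ = w.alphaGamma + l
  betaGamma : restartMean ν σ w.alphaGamma (correctorMeanNeg μ σ w) ν = w.betaGamma + l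
  maxGamma : restartMean ν σ w.alphaGamma (correctorMeanNeg μ σ w) μ +
    restartMean ν σ w.alphaGamma (correctorMeanNeg μ σ w) ν -
      restartMean ν σ w.alphaGamma (correctorMeanNeg μ σ w) (μ + ν) = l
  betaZero : restartMeanZero ν w.alphaGamma ν = w.betaZero + l
  maxZero : restartMeanZero ν w.alphaGamma μ + restartMeanZero ν w.alphaGamma ν -
    restartMeanZero ν w.alphaGamma (μ + ν) = w.maxZero + l

section Poisson

variable [IsProbabilityMeasure P] {μ ν σ : ℝ} (hμ : 0 < μ) (hν : 0 < ν) (hσ : 0 < σ)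
  {w : RegimeExcess}

include hμ hν hσ

theorem integral_potential_corrector_zero {X : Ω → ℝ} {r : ℝ} (hr : 0 < r)
    (hX : HasLaw X (expMeasure r) P) :
    ∫ ω, potential (corrector μ ν σ w) (X ω) 0 ∂P = restartMeanZero ν w.alphaGamma r := by
  rw [integral_potential_zero (measurable_corrector w) (abs_corrector_le w hμ.le hν.le hσ.le) hr
    hX, integral_corrector_expMeasure w hr (add_pos hr hν), restartMeanZero]

theorem integral_potential_corrector {X Y : Ω → ℝ} {r : ℝ} (hr : 0 < r)
    (hX : HasLaw X (expMeasure r) P) (hY : HasLaw Y (expMeasure σ) P) (hXY : IndepFun X Y P) :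
    ∫ ω, potential (corrector μ ν σ w) (X ω) (Y ω) ∂P =
      restartMean ν σ w.alphaGamma (correctorMeanNeg μ σ w) r := by
  rw [integral_potential_of_indepFun (measurable_corrector w)
    (abs_corrector_le w hμ.le hν.le hσ.le) hr hσ hX hY hXY,
    integral_corrector_expMeasure w hr (add_pos hr hν),
    integral_corrector_neg_expMeasure w hσ hμ hσ, restartMean, restartMeanZero, correctorMeanNeg]

variable {a b c : Ω → ℝ} (ha : HasLaw a (expMeasure μ) P) (hb : HasLaw b (expMeasure ν) P)

include ha hb

theorem integral_potential_corrector_max_zero (hab : IndepFun a b P) :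
    ∫ ω, potential (corrector μ ν σ w) (max (a ω) (b ω)) 0 ∂P =
      restartMeanZero ν w.alphaGamma μ + restartMeanZero ν w.alphaGamma ν -
        restartMeanZero ν w.alphaGamma (μ + ν) := by
  rw [integral_potential_max (measurable_corrector w) (abs_corrector_le w hμ.le hν.le hσ.le)
    (integrable_of_hasLaw_expMeasure hμ ha) (integrable_of_hasLaw_expMeasure hν hb)
    (integrable_const 0),
    integral_potential_corrector_zero hμ hν hσ hμ ha,
    integral_potential_corrector_zero hμ hν hσ hν hb,
    integral_potential_corrector_zero hμ hν hσ (add_pos hμ hν)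
      (hasLaw_min_of_indepFun hμ hν ha hb hab)]

variable (hc : HasLaw c (expMeasure σ) P)

include hc

theorem integral_potential_corrector_max (hab : IndepFun a b P)
    (hab_c : IndepFun (fun ω => (a ω, b ω)) c P) :
    ∫ ω, potential (corrector μ ν σ w) (max (a ω) (b ω)) (c ω) ∂P =
      restartMean ν σ w.alphaGamma (correctorMeanNeg μ σ w) μ +
        restartMean ν σ w.alphaGamma (correctorMeanNeg μ σ w) ν -
          restartMean ν σ w.alphaGamma (correctorMeanNeg μ σ w) (μ + ν) := by
  rw [integral_potential_max (measurable_corrector w) (abs_corrector_le w hμ.le hν.le hσ.le)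
    (integrable_of_hasLaw_expMeasure hμ ha) (integrable_of_hasLaw_expMeasure hν hb)
    (integrable_of_hasLaw_expMeasure hσ hc),
    integral_potential_corrector hμ hν hσ hμ ha hc (hab_c.comp measurable_fst measurable_id),
    integral_potential_corrector hμ hν hσ hν hb hc (hab_c.comp measurable_snd measurable_id),
    integral_potential_corrector hμ hν hσ (add_pos hμ hν)
      (hasLaw_min_of_indepFun hμ hν ha hb hab) hc
      (hab_c.comp (measurable_fst.min measurable_snd) measurable_id)]

theorem integral_potential_corrector_step (habc : iIndepFun ![a, b, c] P) {l : ℝ}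
    (hw : IsPoissonSolution μ ν σ w l) (x y : ℝ) :
    ∫ ω, potential (corrector μ ν σ w) (max (x + a ω) (y + b ω)) (max (x + c ω) y) ∂P =
      potential (corrector μ ν σ w) x y + l := by
  have aemeasurable_abc (i : Fin 3) : AEMeasurable (![a, b, c] i) P := by
    fin_cases i
    exacts [ha.aemeasurable, hb.aemeasurable, hc.aemeasurable]
  have hab : IndepFun a b P := habc.indepFun (i := 0) (j := 1) (by decide)
  have hab_c : IndepFun (fun ω => (a ω, b ω)) c P :=
    habc.indepFun_prodMk₀ aemeasurable_abc 0 1 2 (by decide) (by decide)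
  have hac_b : IndepFun (fun ω => (a ω, c ω)) b P :=
    habc.indepFun_prodMk₀ aemeasurable_abc 0 2 1 (by decide) (by decide)
  have hbc_a : IndepFun (fun ω => (b ω, c ω)) a P :=
    habc.indepFun_prodMk₀ aemeasurable_abc 1 2 0 (by decide) (by decide)
  have hac : IndepFun a c P := hab_c.comp measurable_fst measurable_id
  have hbc : IndepFun b c P := hab_c.comp measurable_snd measurable_id
  rcases le_total y x with hyx | hxy
  · rw [integral_potential_step_of_le_left (measurable_corrector w)
      (abs_corrector_le w hμ.le hν.le hσ.le) hν (integrable_of_hasLaw_expMeasure hμ ha)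
      (ae_nonneg_of_hasLaw_expMeasure ha) hb (integrable_of_hasLaw_expMeasure hσ hc)
      (ae_nonneg_of_hasLaw_expMeasure hc) hac_b.symm hyx,
      integral_potential_corrector hμ hν hσ hμ ha hc hac,
      integral_potential_corrector_max hμ hν hσ ha hb hc hab hab_c, hw.maxGamma, hw.alphaGamma,
      potential, max_eq_left hyx, corrector_of_nonneg w (sub_nonneg.2 hyx)]
    ring
  · rw [integral_potential_step_of_le_right (measurable_corrector w)
      (abs_corrector_le w hμ.le hν.le hσ.le) hμ hσ ha (integrable_of_hasLaw_expMeasure hν hb)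
      (ae_nonneg_of_hasLaw_expMeasure hb) hc hbc_a.symm hab_c.symm hxy,
      integral_potential_corrector hμ hν hσ hν hb hc hbc,
      integral_potential_corrector_zero hμ hν hσ hν hb,
      integral_potential_corrector_max_zero hμ hν hσ ha hb hab,
      integral_potential_corrector_max hμ hν hσ ha hb hc hab hab_c, hw.maxGamma, hw.betaGamma,
      hw.maxZero, hw.betaZero, potential, max_eq_right hxy,
      corrector_of_nonpos w (sub_nonpos.2 hxy), neg_sub]
    ring

end Poisson

/-! ### Strong laws along squares -/

theorem integral_sq_le_of_orthogonal_increments {S : ℕ → Ω → ℝ} {K : ℝ} (hS : ∀ n, MemLp (S n) 2 P)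
    (hS₀ : S 0 = 0) (orthogonal : ∀ n, ∫ ω, S n ω * (S (n + 1) ω - S n ω) ∂P = 0)
    (integral_sq_increment_le : ∀ n, ∫ ω, (S (n + 1) ω - S n ω) ^ 2 ∂P ≤ K) (n : ℕ) :
    ∫ ω, S n ω ^ 2 ∂P ≤ K * n := by
  induction n with
  | zero => simp [hS₀]
  | succ n ih =>
    have memLp_increment : MemLp (fun ω => S (n + 1) ω - S n ω) 2 P := (hS (n + 1)).sub (hS n)
    have integrable_mul : Integrable (fun ω => S n ω * (S (n + 1) ω - S n ω)) P :=
      (hS n).integrable_mul memLp_increment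
    have pythagoras : ∫ ω, S (n + 1) ω ^ 2 ∂P =
        ∫ ω, S n ω ^ 2 ∂P + ∫ ω, (S (n + 1) ω - S n ω) ^ 2 ∂P := by
      calc ∫ ω, S (n + 1) ω ^ 2 ∂P
          = ∫ ω, (S n ω ^ 2 + 2 * (S n ω * (S (n + 1) ω - S n ω)) +
              (S (n + 1) ω - S n ω) ^ 2) ∂P := by
            congr 1 with ω
            ring
        _ = _ := by
            rw [integral_add ((hS n).integrable_sq.fun_add (integrable_mul.const_mul 2))
              memLp_increment.integrable_sq, integral_add (hS n).integrable_sq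
              (integrable_mul.const_mul 2), integral_const_mul, orthogonal, mul_zero, add_zero]
    push_cast
    linarith [integral_sq_increment_le n]

theorem ae_tendsto_zero_of_summable_integral_sq {X : ℕ → Ω → ℝ} (hX : ∀ n, MemLp (X n) 2 P)
    {u : ℕ → ℝ} (hu : Summable u) (hXu : ∀ n, ∫ ω, X n ω ^ 2 ∂P ≤ u n) :
    ∀ᵐ ω ∂P, Tendsto (fun n => X n ω) atTop (𝓝 0) := by
  have aemeasurable_sq (n : ℕ) : AEMeasurable (fun ω => ENNReal.ofReal (X n ω ^ 2)) P :=
    ((hX n).1.aemeasurable.pow_const 2).ennreal_ofReal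
  have lintegral_sq_le (n : ℕ) : ∫⁻ ω, ENNReal.ofReal (X n ω ^ 2) ∂P ≤ ENNReal.ofReal (u n) := by
    rw [← ofReal_integral_eq_lintegral_ofReal (hX n).integrable_sq
      (ae_of_all _ fun ω => sq_nonneg _)]
    exact ENNReal.ofReal_le_ofReal (hXu n)
  have lintegral_tsum_ne_top : ∫⁻ ω, ∑' n, ENNReal.ofReal (X n ω ^ 2) ∂P ≠ ⊤ := by
    rw [lintegral_tsum aemeasurable_sq]
    exact ne_top_of_le_ne_top hu.tsum_ofReal_ne_top (ENNReal.tsum_le_tsum lintegral_sq_le)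
  filter_upwards [ae_lt_top' (.tsum aemeasurable_sq) lintegral_tsum_ne_top] with ω tsum_lt_top
  have sq_tendsto : Tendsto (fun n => X n ω ^ 2) atTop (𝓝 0) := by
    simpa [Function.comp_def, ENNReal.toReal_ofReal (sq_nonneg _)] using
      (ENNReal.tendsto_toReal ENNReal.zero_ne_top).comp
        (ENNReal.tendsto_atTop_zero_of_tsum_ne_top tsum_lt_top.ne)
  refine (tendsto_zero_iff_abs_tendsto_zero _).2 ?_
  simpa [Function.comp_def, Real.sqrt_sq_eq_abs] using sq_tendsto.sqrt

theorem ae_tendsto_div_sq_of_integral_sq_le {S : ℕ → Ω → ℝ} {K : ℝ} (hS : ∀ n, MemLp (S n) 2 P)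
    (hK : ∀ n : ℕ, ∫ ω, S n ω ^ 2 ∂P ≤ K * n) :
    ∀ᵐ ω ∂P, Tendsto (fun n : ℕ => S (n ^ 2) ω / ((n ^ 2 : ℕ) : ℝ)) atTop (𝓝 0) := by
  refine ae_tendsto_zero_of_summable_integral_sq
    (fun n => by simpa only [div_eq_mul_inv] using (hS (n ^ 2)).mul_const _)
    ((Real.summable_one_div_nat_pow.2 one_lt_two).mul_left K) fun n => ?_
  simp_rw [div_pow, integral_div]
  rcases n.eq_zero_or_pos with rfl | hn
  · simp
  · rw [div_le_iff₀ (by positivity)]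
    refine (hK (n ^ 2)).trans_eq ?_
    push_cast
    field_simp

theorem tendsto_div_of_monotone_of_tendsto_sq {u : ℕ → ℝ} {l : ℝ} (hu : Monotone u)
    (hl : Tendsto (fun n : ℕ => u (n ^ 2) / ((n ^ 2 : ℕ) : ℝ)) atTop (𝓝 l)) :
    Tendsto (fun n : ℕ => u n / n) atTop (𝓝 l) := by
  refine tendsto_div_of_monotone_of_exists_subseq_tendsto_div u l hu fun a ha =>
    ⟨fun n => n ^ 2, ?_, tendsto_pow_atTop two_ne_zero, hl⟩
  have ratio_tendsto : Tendsto (fun n : ℕ => (1 + 1 / (n : ℝ)) ^ 2) atTop (𝓝 1) := by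
    simpa using ((tendsto_one_div_atTop_nhds_zero_nat (𝕜 := ℝ)).const_add 1).pow 2
  filter_upwards [ratio_tendsto.eventually_le_const ha, eventually_gt_atTop 0] with n ratio_le hn
  push_cast
  calc ((n : ℝ) + 1) ^ 2 = (1 + 1 / (n : ℝ)) ^ 2 * (n : ℝ) ^ 2 := by field_simp
    _ ≤ a * (n : ℝ) ^ 2 := by gcongr

section Recursion

variable {ι E F : Type*} [MeasurableSpace E] [MeasurableSpace F] {X : ι × ℕ → Ω → F}
  {f : E → (ι → F) → E} {z : ℕ → Ω → E} {v : E}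

theorem exists_measurable_eq_of_recursion {Ω : Type*} [Fintype ι] {X : ι × ℕ → Ω → F}
    {z : ℕ → Ω → E} (hf : Measurable (Function.uncurry f)) (hz₀ : ∀ ω, z 0 ω = v)
    (hz : ∀ n ω, z (n + 1) ω = f (z n ω) fun i => X (i, n) ω) (n : ℕ) :
    ∃ ψ : ((Finset.univ ×ˢ Finset.range n : Finset (ι × ℕ)) → F) → E,
      Measurable ψ ∧ ∀ ω, z n ω = ψ fun p => X p ω := by
  induction n with
  | zero => exact ⟨fun _ => v, measurable_const, hz₀⟩
  | succ n ih =>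
    obtain ⟨ψ, measurable_ψ, z_eq⟩ := ih
    have subset : Finset.univ ×ˢ Finset.range n ⊆
        (Finset.univ ×ˢ Finset.range (n + 1) : Finset (ι × ℕ)) :=
      Finset.product_subset_product_right (Finset.range_subset_range.2 n.le_succ)
    have mem (i : ι) : (i, n) ∈ (Finset.univ ×ˢ Finset.range (n + 1) : Finset (ι × ℕ)) := by simp
    refine ⟨fun u => f (ψ (Finset.restrict₂ (π := fun _ => F) subset u)) fun i => u ⟨(i, n), mem i⟩,
      ?_, fun ω => ?_⟩
    · exact hf.comp ((measurable_ψ.comp (Finset.measurable_restrict₂ subset)).prodMk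
        (measurable_pi_lambda _ fun i => measurable_pi_apply _))
    · rw [hz, z_eq]
      rfl

theorem indepFun_of_recursion [Finite ι] (hX : ∀ p, AEMeasurable (X p) P)
    (hindep : iIndepFun X P) (hf : Measurable (Function.uncurry f)) (hz₀ : ∀ ω, z 0 ω = v)
    (hz : ∀ n ω, z (n + 1) ω = f (z n ω) fun i => X (i, n) ω) (n : ℕ) :
    IndepFun (z n) (fun ω i => X (i, n) ω) P := by
  have := Fintype.ofFinite ι
  obtain ⟨ψ, measurable_ψ, z_eq⟩ := exists_measurable_eq_of_recursion hf hz₀ hz n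
  have disjoint : Disjoint (Finset.univ ×ˢ Finset.range n : Finset (ι × ℕ))
      (Finset.univ ×ˢ {n}) :=
    Finset.disjoint_product.2 (Or.inr (by simp))
  have measurable_last : Measurable fun (u : (Finset.univ ×ˢ {n} : Finset (ι × ℕ)) → F) (i : ι) =>
      u ⟨(i, n), by simp⟩ :=
    measurable_pi_lambda _ fun i => measurable_pi_apply _
  rw [funext z_eq]
  exact (hindep.indepFun_finset₀ _ _ disjoint hX).comp measurable_ψ measurable_last

end Recursion

theorem aemeasurable_of_recursion {E F : Type*} [MeasurableSpace E] [MeasurableSpace F]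
    {z : ℕ → Ω → E} {W : ℕ → Ω → F} {f : E → F → E} {v : E}
    (hz₀ : ∀ ω, z 0 ω = v) (hz : ∀ n ω, z (n + 1) ω = f (z n ω) (W n ω))
    (hW : ∀ n, AEMeasurable (W n) P) (hf : Measurable (Function.uncurry f)) (n : ℕ) :
    AEMeasurable (z n) P := by
  induction n with
  | zero => exact funext hz₀ ▸ aemeasurable_const
  | succ n ih => exact funext (hz n) ▸ hf.comp_aemeasurable (ih.prodMk (hW n))

theorem memLp_of_memLp_increments {S : ℕ → Ω → ℝ} {p : ENNReal} (hS₀ : S 0 = 0)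
    (hS : ∀ n, MemLp (fun ω => S (n + 1) ω - S n ω) p P) (n : ℕ) : MemLp (S n) p P := by
  induction n with
  | zero => exact hS₀ ▸ MemLp.zero
  | succ n ih => exact (ih.add (hS n)).ae_eq (ae_of_all _ fun ω => by simp)

theorem tendsto_div_of_tendsto_centered_div {ι : Type*} {F : Filter ι} {a N : ι → ℝ} {c l : ℝ}
    (hN : Tendsto N F atTop) (ha : Tendsto (fun i => (a i - c - l * N i) / N i) F (𝓝 0)) :
    Tendsto (fun i => a i / N i) F (𝓝 l) := by
  have sum_tendsto := (ha.add (hN.const_div_atTop c)).add_const l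
  rw [add_zero, zero_add] at sum_tendsto
  refine sum_tendsto.congr' ?_
  filter_upwards [hN.eventually_gt_atTop 0] with i hi
  field_simp
  ring

section PoissonEquation

variable [IsProbabilityMeasure P] {E F : Type*} [MeasurableSpace E] [MeasurableSpace F]
  {κ : Measure F}

theorem integral_sub_const_eq_zero [IsProbabilityMeasure κ] {u g : F → ℝ} {c : ℝ}
    (hu : AEStronglyMeasurable u κ) (hg : Integrable g κ) (abs_sub_le : ∀ w, |u w - c| ≤ g w)
    (integral_u : ∫ w, u w ∂κ = c) : ∫ w, (u w - c) ∂κ = 0 := by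
  have integrable_sub : Integrable (fun w => u w - c) κ :=
    hg.mono' (hu.sub aestronglyMeasurable_const) (ae_of_all _ abs_sub_le)
  have integrable_u : Integrable u κ :=
    (integrable_sub.add (integrable_const c)).congr (ae_of_all _ fun w => sub_add_cancel _ _)
  rw [integral_sub integrable_u (integrable_const c), integral_u, integral_const, probReal_univ,
    one_smul, sub_self]

theorem integral_mul_eq_zero_of_indepFun {Z : Ω → E} {W : Ω → F} (hZ : AEMeasurable Z P)
    (hW : HasLaw W κ P) (hZW : IndepFun Z W P) {s : E → ℝ} {x : E → F → ℝ} (hs : Measurable s)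
    (hx : Measurable (Function.uncurry x)) (hx₀ : ∀ v, ∫ w, x v w ∂κ = 0)
    (hsx : Integrable (fun ω => s (Z ω) * x (Z ω) (W ω)) P) :
    ∫ ω, s (Z ω) * x (Z ω) (W ω) ∂P = 0 := by
  have := hW.isProbabilityMeasure_iff.1 ‹_›
  have := Measure.isProbabilityMeasure_map hZ
  have law := hZW.hasLaw_prod ⟨hZ, rfl⟩ hW
  have measurable_mul : Measurable fun p : E × F => s p.1 * x p.1 p.2 :=
    (hs.comp measurable_fst).mul hx
  have integrable_mul : Integrable (fun p : E × F => s p.1 * x p.1 p.2) ((P.map Z).prod κ) := by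
    rw [← law.map_eq]
    exact (integrable_map_measure measurable_mul.aestronglyMeasurable law.aemeasurable).2 hsx
  calc ∫ ω, s (Z ω) * x (Z ω) (W ω) ∂P
      = ∫ p, s p.1 * x p.1 p.2 ∂(P.map Z).prod κ :=
        law.integral_comp measurable_mul.aestronglyMeasurable
    _ = 0 := by simp [integral_prod _ integrable_mul, integral_const_mul, hx₀]

theorem ae_tendsto_div_sq_of_poisson {z : ℕ → Ω → E} {W : ℕ → Ω → F} {f : E → F → E} {v₀ : E}
    (hz₀ : ∀ ω, z 0 ω = v₀) (hz : ∀ n ω, z (n + 1) ω = f (z n ω) (W n ω))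
    (hW : ∀ n, HasLaw (W n) κ P) (hzW : ∀ n, IndepFun (z n) (W n) P)
    (hf : Measurable (Function.uncurry f)) {φ : E → ℝ} (hφ : Measurable φ) {g : F → ℝ}
    (hg : MemLp g 2 κ) {l : ℝ} (abs_increment_le : ∀ v w, |φ (f v w) - (φ v + l)| ≤ g w)
    (poisson : ∀ v, ∫ w, φ (f v w) ∂κ = φ v + l) :
    ∀ᵐ ω ∂P, Tendsto (fun n : ℕ => φ (z (n ^ 2) ω) / ((n ^ 2 : ℕ) : ℝ)) atTop (𝓝 l) := by
  have := (hW 0).isProbabilityMeasure_iff.1 ‹_›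
  have aemeasurable_z := aemeasurable_of_recursion hz₀ hz (fun n => (hW n).aemeasurable) hf
  set x : E → F → ℝ := fun v w => φ (f v w) - (φ v + l) with x_def
  have measurable_x : Measurable (Function.uncurry x) :=
    (hφ.comp hf).sub ((hφ.comp measurable_fst).add_const l)
  have integral_x (v : E) : ∫ w, x v w ∂κ = 0 :=
    integral_sub_const_eq_zero (hφ.comp hf.of_uncurry_left).aestronglyMeasurable
      (hg.integrable one_le_two) (abs_increment_le v) (poisson v)
  have memLp_g (n : ℕ) : MemLp (fun ω => g (W n ω)) 2 P :=
    MemLp.comp_of_map (by rwa [(hW n).map_eq]) (hW n).aemeasurable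
  have memLp_increment (n : ℕ) : MemLp (fun ω => x (z n ω) (W n ω)) 2 P :=
    (memLp_g n).mono' (measurable_x.comp_aemeasurable
      ((aemeasurable_z n).prodMk (hW n).aemeasurable)).aestronglyMeasurable
      (ae_of_all _ fun ω => abs_increment_le _ _)
  set S : ℕ → Ω → ℝ := fun n ω => φ (z n ω) - φ v₀ - l * n with S_def
  have S_zero : S 0 = 0 := by
    ext ω
    simp [S_def, hz₀]
  have increment (n : ℕ) (ω : Ω) : S (n + 1) ω - S n ω = x (z n ω) (W n ω) := by
    simp only [S_def, x_def, hz]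
    push_cast
    ring
  have memLp_S : ∀ n, MemLp (S n) 2 P :=
    memLp_of_memLp_increments S_zero fun n => by simpa only [increment] using memLp_increment n
  have integral_sq_le : ∀ n : ℕ, ∫ ω, S n ω ^ 2 ∂P ≤ (∫ w, g w ^ 2 ∂κ) * n := by
    refine integral_sq_le_of_orthogonal_increments memLp_S S_zero (fun n => ?_) fun n => ?_
    · simp_rw [increment]
      exact integral_mul_eq_zero_of_indepFun (s := fun v => φ v - φ v₀ - l * n) (aemeasurable_z n)
        (hW n) (hzW n) ((hφ.sub_const _).sub_const _) measurable_x integral_x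
        ((memLp_S n).integrable_mul (memLp_increment n))
    · simp_rw [increment]
      rw [← (hW n).integral_comp (f := fun w => g w ^ 2) (hg.1.pow 2)]
      exact integral_mono (memLp_increment n).integrable_sq (memLp_g n).integrable_sq
        fun ω => sq_le_sq.2 ((abs_increment_le _ _).trans (le_abs_self _))
  filter_upwards [ae_tendsto_div_sq_of_integral_sq_le memLp_S integral_sq_le] with ω S_div_tendsto
  exact tendsto_div_of_tendsto_centered_div
    (tendsto_natCast_atTop_atTop.comp (tendsto_pow_atTop two_ne_zero)) S_div_tendsto

end PoissonEquation

/-! ### The max-plus system -/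

theorem max_le_max_maxPlusMulVec {A : Matrix (Fin 2) (Fin 2) ℝ} (h₀ : 0 ≤ A 0 0) (h₁ : 0 ≤ A 1 1)
    (v : Fin 2 → ℝ) :
    max (v 0) (v 1) ≤ max (maxPlusMulVec A v 0) (maxPlusMulVec A v 1) := by
  unfold maxPlusMulVec
  grind

theorem abs_max_maxPlusMulVec_sub_le (A : Matrix (Fin 2) (Fin 2) ℝ) (v : Fin 2 → ℝ) :
    |max (maxPlusMulVec A v 0) (maxPlusMulVec A v 1) - max (v 0) (v 1)| ≤
      |A 0 0| + |A 0 1| + |A 1 0| + |A 1 1| := by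
  have abs_entry_le (i j : Fin 2) : |A i j| ≤ |A 0 0| + |A 0 1| + |A 1 0| + |A 1 1| := by
    have := fun i j => abs_nonneg (A i j)
    fin_cases i <;> fin_cases j <;> simp only [Fin.zero_eta, Fin.mk_one] <;>
      linarith [this 0 0, this 0 1, this 1 0, this 1 1]
  have maxPlusMulVec_le (i : Fin 2) : maxPlusMulVec A v i ≤
      max (v 0) (v 1) + (|A 0 0| + |A 0 1| + |A 1 0| + |A 1 1|) :=
    max_le (add_le_add (le_max_left _ _) ((le_abs_self _).trans (abs_entry_le i 0)))
      (add_le_add (le_max_right _ _) ((le_abs_self _).trans (abs_entry_le i 1)))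
  have le_maxPlusMulVec (j : Fin 2) : v j - (|A 0 0| + |A 0 1| + |A 1 0| + |A 1 1|) ≤
      maxPlusMulVec A v 0 := by
    have : v j + A 0 j ≤ maxPlusMulVec A v 0 := by
      fin_cases j
      exacts [le_max_left _ _, le_max_right _ _]
    linarith [neg_abs_le (A 0 j), abs_entry_le 0 j]
  refine abs_sub_le_iff.2 ⟨?_, ?_⟩
  · rw [sub_le_iff_le_add']
    exact max_le (maxPlusMulVec_le 0) (maxPlusMulVec_le 1)
  · rw [sub_le_comm, ← max_sub_sub_right]
    exact (max_le (le_maxPlusMulVec 0) (le_maxPlusMulVec 1)).trans (le_max_left _ _)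

theorem abs_potential_maxPlusMulVec_sub_le {h : ℝ → ℝ} {B : ℝ} (hB : ∀ d, |h d| ≤ B)
    (A : Matrix (Fin 2) (Fin 2) ℝ) (v : Fin 2 → ℝ) (l : ℝ) :
    |potential h (maxPlusMulVec A v 0) (maxPlusMulVec A v 1) - (potential h (v 0) (v 1) + l)| ≤
      |A 0 0| + |A 0 1| + |A 1 0| + |A 1 1| + (2 * B + |l|) := by
  have max_increment := abs_le.1 (abs_max_maxPlusMulVec_sub_le A v)
  have new_le := abs_le.1 (hB (maxPlusMulVec A v 0 - maxPlusMulVec A v 1))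
  have old_le := abs_le.1 (hB (v 0 - v 1))
  unfold potential
  rw [abs_le]
  constructor <;> linarith [le_abs_self l, neg_abs_le l]

theorem monotone_max_maxPlusState {A : ℕ → Matrix (Fin 2) (Fin 2) ℝ} (h₀ : ∀ k, 0 ≤ A k 0 0)
    (h₁ : ∀ k, 0 ≤ A k 1 1) :
    Monotone fun k => max (maxPlusState A k 0) (maxPlusState A k 1) :=
  monotone_nat_of_le_succ fun k => max_le_max_maxPlusMulVec (h₀ k) (h₁ k) _

/-- The matrix `A` of the max-plus system with the random entries `(α, β, γ) = w`. -/
def entryMatrix (w : Fin 3 → ℝ) : Matrix (Fin 2) (Fin 2) ℝ := !![w 0, w 1; w 2, 0]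

theorem measurable_maxPlusMulVec_entryMatrix :
    Measurable (Function.uncurry fun v w => maxPlusMulVec (entryMatrix w) v) := by
  have measurable_entry (i j : Fin 2) : Measurable fun w => entryMatrix w i j := by
    fin_cases i <;> fin_cases j
    exacts [measurable_pi_apply 0, measurable_pi_apply 1, measurable_pi_apply 2, measurable_const]
  unfold maxPlusMulVec Function.uncurry
  fun_prop

/-- The law of the triple of entries of the matrix `A` of the system. -/
noncomputable def entryLaw (μ ν σ : ℝ) : Measure (Fin 3 → ℝ) :=
  Measure.pi fun i => expMeasure (![μ, ν, σ] i)

section EntryLaw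

variable {μ ν σ : ℝ} (hμ : 0 < μ) (hν : 0 < ν) (hσ : 0 < σ)

include hμ hν hσ

theorem pos_rates (i : Fin 3) : 0 < ![μ, ν, σ] i := by
  fin_cases i <;> assumption

theorem isProbabilityMeasure_entryLaw : IsProbabilityMeasure (entryLaw μ ν σ) := by
  have (i : Fin 3) := isProbabilityMeasure_expMeasure (pos_rates hμ hν hσ i)
  unfold entryLaw
  infer_instance

theorem hasLaw_eval_entryLaw (i : Fin 3) :
    HasLaw (Function.eval i) (expMeasure (![μ, ν, σ] i)) (entryLaw μ ν σ) := by
  have (i : Fin 3) := isProbabilityMeasure_expMeasure (pos_rates hμ hν hσ i)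
  exact (measurePreserving_eval (fun i => expMeasure (![μ, ν, σ] i)) i).hasLaw

theorem iIndepFun_eval_entryLaw :
    iIndepFun (fun (i : Fin 3) (w : Fin 3 → ℝ) => w i) (entryLaw μ ν σ) := by
  have (i : Fin 3) := isProbabilityMeasure_expMeasure (pos_rates hμ hν hσ i)
  exact iIndepFun_pi (μ := fun i => expMeasure (![μ, ν, σ] i)) (X := fun _ => id)
    fun _ => aemeasurable_id

theorem memLp_eval_entryLaw (i : Fin 3) (p : NNReal) :
    MemLp (fun w => w i) p (entryLaw μ ν σ) :=
  ((hasLaw_eval_entryLaw hμ hν hσ i).identDistrib .id).memLp_iff.2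
    (memLp_id_expMeasure (pos_rates hμ hν hσ i) p)

theorem memLp_entryMatrix (i j : Fin 2) (p : NNReal) :
    MemLp (fun w => entryMatrix w i j) p (entryLaw μ ν σ) := by
  have := isProbabilityMeasure_entryLaw hμ hν hσ
  have memLp_eval := fun i => memLp_eval_entryLaw hμ hν hσ i p
  fin_cases i <;> fin_cases j
  exacts [memLp_eval 0, memLp_eval 1, memLp_eval 2, memLp_const 0]

theorem integral_potential_corrector_maxPlusMulVec {w : RegimeExcess} {l : ℝ}
    (hw : IsPoissonSolution μ ν σ w l) (v : Fin 2 → ℝ) :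
    ∫ u, potential (corrector μ ν σ w) (maxPlusMulVec (entryMatrix u) v 0)
        (maxPlusMulVec (entryMatrix u) v 1) ∂entryLaw μ ν σ =
      potential (corrector μ ν σ w) (v 0) (v 1) + l := by
  have := isProbabilityMeasure_entryLaw hμ hν hσ
  have law := hasLaw_eval_entryLaw hμ hν hσ
  have indep : iIndepFun ![Function.eval 0, Function.eval 1, Function.eval 2]
      (entryLaw μ ν σ) := by
    convert iIndepFun_eval_entryLaw hμ hν hσ using 1
    ext i u
    fin_cases i <;> rfl
  simpa [maxPlusMulVec, entryMatrix] using
    integral_potential_corrector_step hμ hν hσ (law 0) (law 1) (law 2) indep hw (v 0) (v 1)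

theorem ae_tendsto_potential_maxPlusState_div_sq [IsProbabilityMeasure P] {X : Fin 3 × ℕ → Ω → ℝ}
    (hX : ∀ i k, HasLaw (X (i, k)) (expMeasure (![μ, ν, σ] i)) P) (hindep : iIndepFun X P)
    {w : RegimeExcess} {l : ℝ} (hw : IsPoissonSolution μ ν σ w l) :
    ∀ᵐ ω ∂P, Tendsto (fun n : ℕ => potential (corrector μ ν σ w)
      (maxPlusState (fun k => entryMatrix fun i => X (i, k) ω) (n ^ 2) 0)
      (maxPlusState (fun k => entryMatrix fun i => X (i, k) ω) (n ^ 2) 1) / ((n ^ 2 : ℕ) : ℝ))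
      atTop (𝓝 l) := by
  have := isProbabilityMeasure_entryLaw hμ hν hσ
  set z : ℕ → Ω → Fin 2 → ℝ :=
    fun n ω => maxPlusState (fun k => entryMatrix fun i => X (i, k) ω) n
  have z_zero (ω : Ω) : z 0 ω = 0 := rfl
  have z_succ (n : ℕ) (ω : Ω) :
      z (n + 1) ω = maxPlusMulVec (entryMatrix fun i => X (i, n) ω) (z n ω) := rfl
  have law_entries (n : ℕ) : HasLaw (fun ω i => X (i, n) ω) (entryLaw μ ν σ) P :=
    (hindep.precomp (g := fun i => (i, n)) fun i j hij => congrArg Prod.fst hij).hasLaw_pi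
      fun i => hX i n
  have memLp_abs_entry (i j : Fin 2) : MemLp (fun u => |entryMatrix u i j|) 2 (entryLaw μ ν σ) :=
    (memLp_entryMatrix hμ hν hσ i j 2).abs
  have measurable_potential_corrector : Measurable fun v : Fin 2 → ℝ =>
      potential (corrector μ ν σ w) (v 0) (v 1) :=
    (measurable_potential (measurable_corrector w)).comp
      (f := fun v : Fin 2 → ℝ => (v 0, v 1)) (by fun_prop)
  exact ae_tendsto_div_sq_of_poisson z_zero z_succ law_entries
    (indepFun_of_recursion (fun p => (hX p.1 p.2).aemeasurable) hindep
      measurable_maxPlusMulVec_entryMatrix z_zero z_succ)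
    measurable_maxPlusMulVec_entryMatrix measurable_potential_corrector
    (((((memLp_abs_entry 0 0).add (memLp_abs_entry 0 1)).add (memLp_abs_entry 1 0)).add
      (memLp_abs_entry 1 1)).add (memLp_const _))
    (fun v u => abs_potential_maxPlusMulVec_sub_le (abs_corrector_le w hμ.le hν.le hσ.le)
      (entryMatrix u) v l)
    (integral_potential_corrector_maxPlusMulVec hμ hν hσ hw)

end EntryLaw

theorem tendsto_max_div_of_tendsto_potential_div {ι : Type*} {F : Filter ι} {h : ℝ → ℝ} {B l : ℝ}
    (hB : ∀ d, |h d| ≤ B) {x y N : ι → ℝ} (hN : Tendsto N F atTop)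
    (hl : Tendsto (fun i => potential h (x i) (y i) / N i) F (𝓝 l)) :
    Tendsto (fun i => max (x i) (y i) / N i) F (𝓝 l) := by
  have correction_tendsto : Tendsto (fun i => h (x i - y i) / N i) F (𝓝 0) :=
    tendsto_bdd_div_atTop_nhds_zero (.of_forall fun _ => neg_le_of_abs_le (hB _))
      (.of_forall fun _ => le_of_abs_le (hB _)) hN
  simpa [potential, add_div] using hl.sub correction_tendsto

theorem isLyapunovExponent_of_isPoissonSolution [IsProbabilityMeasure P] {μ ν σ : ℝ} (hμ : 0 < μ)
    (hν : 0 < ν) (hσ : 0 < σ) {α β γ : ℕ → Ω → ℝ} (hα : ∀ k, HasLaw (α k) (expMeasure μ) P)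
    (hβ : ∀ k, HasLaw (β k) (expMeasure ν) P) (hγ : ∀ k, HasLaw (γ k) (expMeasure σ) P)
    (hindep : iIndepFun (fun p : Fin 3 × ℕ => ![α, β, γ] p.1 p.2) P) {w : RegimeExcess} {l : ℝ}
    (hw : IsPoissonSolution μ ν σ w l) :
    IsLyapunovExponent P (fun k ω => !![α k ω, β k ω; γ k ω, 0]) l := by
  have law (i : Fin 3) (k : ℕ) : HasLaw (![α, β, γ] i k) (expMeasure (![μ, ν, σ] i)) P := by
    fin_cases i
    exacts [hα k, hβ k, hγ k]
  filter_upwards [ae_tendsto_potential_maxPlusState_div_sq hμ hν hσ law hindep hw,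
    ae_all_iff.2 fun k => ae_nonneg_of_hasLaw_expMeasure (hα k)] with ω potential_tendsto α_nonneg
  simp_rw [one_div_mul_eq_div]
  exact tendsto_div_of_monotone_of_tendsto_sq
    (monotone_max_maxPlusState α_nonneg fun _ => le_rfl)
    (tendsto_max_div_of_tendsto_potential_div (abs_corrector_le w hμ.le hν.le hσ.le)
      (tendsto_natCast_atTop_atTop.comp (tendsto_pow_atTop two_ne_zero)) potential_tendsto)

/-! ### Solution of the linear system -/

/-- The common denominator of the solution of the linear system `IsPoissonSolution`, up to monomial
and linear factors, in terms of the rate `μ`, the sum `p = ν + σ` and the product `q = ν * σ`. -/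
def poissonDet (μ p q : ℝ) : ℝ :=
  6 * μ ^ 5 * p + μ ^ 4 * (24 * p ^ 2 + q) + μ ^ 3 * (30 * p ^ 3 + 23 * p * q) +
    μ ^ 2 * (12 * p ^ 4 + 50 * p ^ 2 * q + 5 * q ^ 2) + μ * (28 * p ^ 3 * q + 16 * p * q ^ 2) +
      16 * p ^ 2 * q ^ 2

theorem poissonDet_pos {μ p q : ℝ} (hμ : 0 < μ) (hp : 0 < p) (hq : 0 < q) :
    0 < poissonDet μ p q := by
  unfold poissonDet
  positivity

/-- The numerator of the Lyapunov exponent, in terms of the rate `μ`, the sum `p = ν + σ` and the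
product `q = ν * σ`. -/
def lyapunovNumerator (μ p q : ℝ) : ℝ :=
  μ ^ 8 * (4 * p ^ 2 - q) + μ ^ 7 * (20 * p ^ 3 - 4 * p * q) +
    μ ^ 6 * (36 * p ^ 4 + 13 * p ^ 2 * q - 4 * q ^ 2) +
    μ ^ 5 * (28 * p ^ 5 + 62 * p ^ 3 * q - 5 * p * q ^ 2) +
    μ ^ 4 * (8 * p ^ 6 + 74 * p ^ 4 * q + 35 * p ^ 2 * q ^ 2 + 2 * q ^ 3) +
    μ ^ 3 * (28 * p ^ 5 * q + 76 * p ^ 3 * q ^ 2 + 44 * p * q ^ 3) +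
    μ ^ 2 * (40 * p ^ 4 * q ^ 2 + 82 * p ^ 2 * q ^ 3 + 5 * q ^ 4) +
    μ * (44 * p ^ 3 * q ^ 3 + 16 * p * q ^ 4) + 16 * p ^ 2 * q ^ 4

/-- The Lyapunov exponent of the system with exponential entries of arbitrary positive rates
`μ`, `ν`, `σ`. -/
noncomputable def lyapunovValue (μ ν σ : ℝ) : ℝ :=
  lyapunovNumerator μ (ν + σ) (ν * σ) /
    (μ * (ν * σ) * ((μ + ν) * (μ + σ)) * poissonDet μ (ν + σ) (ν * σ))

/-- The excess of the regime `(α, γ)` in the solution of the Poisson equation. -/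
noncomputable def alphaGammaExcess (μ ν σ : ℝ) : ℝ :=
  -(μ ^ 5 * (2 * ν + 4 * σ) + μ ^ 4 * (6 * ν ^ 2 + 24 * ν * σ + 16 * σ ^ 2) +
      μ ^ 3 * (4 * ν ^ 3 + 38 * ν ^ 2 * σ + 62 * ν * σ ^ 2 + 20 * σ ^ 3) +
      μ ^ 2 * (12 * ν ^ 3 * σ + 68 * ν ^ 2 * σ ^ 2 + 56 * ν * σ ^ 3 + 8 * σ ^ 4) +
      μ * (16 * ν ^ 3 * σ ^ 2 + 32 * ν ^ 2 * σ ^ 3 + 16 * ν * σ ^ 4)) /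
    (ν * poissonDet μ (ν + σ) (ν * σ))

/-- The value of `correctorMeanNeg` in the solution of the Poisson equation. -/
noncomputable def solutionMeanNeg (μ ν σ : ℝ) : ℝ :=
  -(μ ^ 6 * (2 * ν + σ) + μ ^ 5 * (10 * ν ^ 2 + 13 * ν * σ + 4 * σ ^ 2) +
      μ ^ 4 * (18 * ν ^ 3 + 45 * ν ^ 2 * σ + 28 * ν * σ ^ 2 + 5 * σ ^ 3) +
      μ ^ 3 * (14 * ν ^ 4 + 67 * ν ^ 3 * σ + 75 * ν ^ 2 * σ ^ 2 + 27 * ν * σ ^ 3 + 2 * σ ^ 4) +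
      μ ^ 2 * (4 * ν ^ 5 + 46 * ν ^ 4 * σ + 103 * ν ^ 3 * σ ^ 2 + 70 * ν ^ 2 * σ ^ 3 +
        10 * ν * σ ^ 4) +
      μ * (12 * ν ^ 5 * σ + 68 * ν ^ 4 * σ ^ 2 + 84 * ν ^ 3 * σ ^ 3 + 28 * ν ^ 2 * σ ^ 4) +
      16 * ν ^ 5 * σ ^ 2 + 32 * ν ^ 4 * σ ^ 3 + 16 * ν ^ 3 * σ ^ 4) /
    (σ * (μ + ν) * poissonDet μ (ν + σ) (ν * σ))

/-- The excesses solving the Poisson equation: given the one of the regime `(α, γ)`, the mean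
`correctorMeanNeg` and the Lyapunov exponent, the equations of `IsPoissonSolution` determine the
other three. -/
noncomputable def poissonExcess (μ ν σ : ℝ) : RegimeExcess where
  alphaGamma := alphaGammaExcess μ ν σ
  betaZero := restartMeanZero ν (alphaGammaExcess μ ν σ) ν - lyapunovValue μ ν σ
  maxZero := restartMeanZero ν (alphaGammaExcess μ ν σ) μ +
    restartMeanZero ν (alphaGammaExcess μ ν σ) ν -
      restartMeanZero ν (alphaGammaExcess μ ν σ) (μ + ν) - lyapunovValue μ ν σ
  betaGamma := restartMean ν σ (alphaGammaExcess μ ν σ) (solutionMeanNeg μ ν σ) ν -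
    lyapunovValue μ ν σ

section PoissonSolution

variable {μ ν σ : ℝ} (hμ : 0 < μ) (hν : 0 < ν) (hσ : 0 < σ)

include hμ hν hσ

theorem restartMean_alphaGammaExcess :
    restartMean ν σ (alphaGammaExcess μ ν σ) (solutionMeanNeg μ ν σ) μ =
      alphaGammaExcess μ ν σ + lyapunovValue μ ν σ := by
  have det_ne_zero := (poissonDet_pos hμ (add_pos hν hσ) (mul_pos hν hσ)).ne'
  simp only [restartMean, restartMeanZero, alphaGammaExcess, solutionMeanNeg, lyapunovValue]
  generalize det_eq : poissonDet μ (ν + σ) (ν * σ) = D at det_ne_zero ⊢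
  field_simp
  subst det_eq
  unfold poissonDet lyapunovNumerator
  ring

theorem restartMean_max_eq_lyapunovValue :
    restartMean ν σ (alphaGammaExcess μ ν σ) (solutionMeanNeg μ ν σ) μ +
      restartMean ν σ (alphaGammaExcess μ ν σ) (solutionMeanNeg μ ν σ) ν -
        restartMean ν σ (alphaGammaExcess μ ν σ) (solutionMeanNeg μ ν σ) (μ + ν) =
      lyapunovValue μ ν σ := by
  have det_ne_zero := (poissonDet_pos hμ (add_pos hν hσ) (mul_pos hν hσ)).ne'
  simp only [restartMean, restartMeanZero, alphaGammaExcess, solutionMeanNeg, lyapunovValue]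
  generalize det_eq : poissonDet μ (ν + σ) (ν * σ) = D at det_ne_zero ⊢
  field_simp
  subst det_eq
  unfold poissonDet lyapunovNumerator
  ring

theorem correctorMeanNeg_poissonExcess :
    correctorMeanNeg μ σ (poissonExcess μ ν σ) = solutionMeanNeg μ ν σ := by
  have det_ne_zero := (poissonDet_pos hμ (add_pos hν hσ) (mul_pos hν hσ)).ne'
  simp only [correctorMeanNeg, poissonExcess, restartMean, restartMeanZero, alphaGammaExcess,
    solutionMeanNeg, lyapunovValue]
  generalize det_eq : poissonDet μ (ν + σ) (ν * σ) = D at det_ne_zero ⊢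
  field_simp
  subst det_eq
  unfold poissonDet lyapunovNumerator
  ring

theorem isPoissonSolution_poissonExcess :
    IsPoissonSolution μ ν σ (poissonExcess μ ν σ) (lyapunovValue μ ν σ) where
  alphaGamma := by
    rw [correctorMeanNeg_poissonExcess hμ hν hσ]
    exact restartMean_alphaGammaExcess hμ hν hσ
  betaGamma := by
    rw [correctorMeanNeg_poissonExcess hμ hν hσ]
    exact (sub_add_cancel _ _).symm
  maxGamma := by
    rw [correctorMeanNeg_poissonExcess hμ hν hσ]
    exact restartMean_max_eq_lyapunovValue hμ hν hσ
  betaZero := (sub_add_cancel _ _).symm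
  maxZero := (sub_add_cancel _ _).symm

end PoissonSolution

theorem lyapunovValue_self_right {μ ν : ℝ} (hμ : 0 < μ) (hν : 0 < ν) :
    lyapunovValue μ ν μ = (48 * μ ^ 5 + 238 * μ ^ 4 * ν + 495 * μ ^ 3 * ν ^ 2 +
        581 * μ ^ 2 * ν ^ 3 + 326 * μ * ν ^ 4 + 68 * ν ^ 5) /
      (2 * μ * ν * (36 * μ ^ 4 + 147 * μ ^ 3 * ν + 215 * μ ^ 2 * ν ^ 2 +
        130 * μ * ν ^ 3 + 28 * ν ^ 4)) := by
  have := poissonDet_pos hμ (add_pos hν hμ) (mul_pos hν hμ)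
  rw [lyapunovValue, div_eq_div_iff (by positivity) (by positivity)]
  unfold poissonDet lyapunovNumerator
  ring

theorem lyapunovValue_self_middle {μ ν : ℝ} (hμ : 0 < μ) (hν : 0 < ν) :
    lyapunovValue μ ν ν = (15 * μ ^ 8 + 152 * μ ^ 7 * ν + 624 * μ ^ 6 * ν ^ 2 +
        1382 * μ ^ 5 * ν ^ 3 + 1838 * μ ^ 4 * ν ^ 4 + 1592 * μ ^ 3 * ν ^ 5 +
        973 * μ ^ 2 * ν ^ 6 + 384 * μ * ν ^ 7 + 64 * ν ^ 8) /
      (μ * ν * (μ + ν) ^ 2 * (12 * μ ^ 5 + 97 * μ ^ 4 * ν + 286 * μ ^ 3 * ν ^ 2 +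
        397 * μ ^ 2 * ν ^ 3 + 256 * μ * ν ^ 4 + 64 * ν ^ 5)) := by
  have := poissonDet_pos hμ (add_pos hν hν) (mul_pos hν hν)
  rw [lyapunovValue, div_eq_div_iff (by positivity) (by positivity)]
  unfold poissonDet lyapunovNumerator
  ring

end

theorem mainTheorem6_general {Ω : Type*} [MeasurableSpace Ω] (P : Measure Ω)
    [IsProbabilityMeasure P] (μ ν σ : ℝ) (hμ : 0 < μ) (hν : 0 < ν) (hσ : 0 < σ)
    (α β γ : ℕ → Ω → ℝ)
    (hα : ∀ k, HasLaw (α k) (expMeasure μ) P)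
    (hβ : ∀ k, HasLaw (β k) (expMeasure ν) P)
    (hγ : ∀ k, HasLaw (γ k) (expMeasure σ) P)
    (hindep : iIndepFun (fun p : Fin 3 × ℕ => ![α, β, γ] p.1 p.2) P) :
    IsLyapunovExponent P (fun k ω => !![α k ω, β k ω; γ k ω, 0]) (lyapunovValue μ ν σ) :=
  isLyapunovExponent_of_isPoissonSolution hμ hν hσ hα hβ hγ hindep
    (isPoissonSolution_poissonExcess hμ hν hσ)

theorem mainTheorem6 {Ω : Type*} [MeasurableSpace Ω] (P : Measure Ω) [IsProbabilityMeasure P]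
    (μ ν σ : ℝ) (hμ : 0 < μ) (hν : 0 < ν) (hσ : 0 < σ)
    (α β γ : ℕ → Ω → ℝ)
    (hα : ∀ k, HasLaw (α k) (expMeasure μ) P)
    (hβ : ∀ k, HasLaw (β k) (expMeasure ν) P)
    (hγ : ∀ k, HasLaw (γ k) (expMeasure σ) P)
    (hindep : iIndepFun (fun p : Fin 3 × ℕ => ![α, β, γ] p.1 p.2) P) :
    (σ = μ →
      IsLyapunovExponent P (fun k ω => !![α k ω, β k ω; γ k ω, 0])
        ((48 * μ ^ 5 + 238 * μ ^ 4 * ν + 495 * μ ^ 3 * ν ^ 2 + 581 * μ ^ 2 * ν ^ 3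
            + 326 * μ * ν ^ 4 + 68 * ν ^ 5) /
          (2 * μ * ν * (36 * μ ^ 4 + 147 * μ ^ 3 * ν + 215 * μ ^ 2 * ν ^ 2
            + 130 * μ * ν ^ 3 + 28 * ν ^ 4)))) ∧
    (σ = ν →
      IsLyapunovExponent P (fun k ω => !![α k ω, β k ω; γ k ω, 0])
        ((15 * μ ^ 8 + 152 * μ ^ 7 * ν + 624 * μ ^ 6 * ν ^ 2 + 1382 * μ ^ 5 * ν ^ 3
            + 1838 * μ ^ 4 * ν ^ 4 + 1592 * μ ^ 3 * ν ^ 5 + 973 * μ ^ 2 * ν ^ 6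
            + 384 * μ * ν ^ 7 + 64 * ν ^ 8) /
          (μ * ν * (μ + ν) ^ 2 * (12 * μ ^ 5 + 97 * μ ^ 4 * ν + 286 * μ ^ 3 * ν ^ 2
            + 397 * μ ^ 2 * ν ^ 3 + 256 * μ * ν ^ 4 + 64 * ν ^ 5)))) := by
  have lyapunov := mainTheorem6_general P μ ν σ hμ hν hσ α β γ hα hβ hγ hindep
  exact ⟨fun hσμ => lyapunovValue_self_right hμ hν ▸ hσμ ▸ lyapunov,
    fun hσν => lyapunovValue_self_middle hμ hν ▸ hσν ▸ lyapunov⟩
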